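/- **Theorem.** Let $f=\frac1m\sum_{i=1}^m f_i:\mathbb{R}^n\to\mathbb{R}$ with every $f_i$ twice differentiable. Suppose that $f$ is twice continuously differentiable, that $\nabla f$ is $L_g$-Lipschitz continuous on $\mathbb{R}^n$ ($L_g>0$), that all level sets $\{x: f(x)\le f(y)\}$, $y\in\mathbb{R}^n$, are bounded, and that $f$ attains its minimum $f_*$. Let $x_0\in\mathbb{R}^n$, $\gamma>1$, $\varepsilon>0$, $\bar\delta\in(0,1)$, $\bar\delta^g<\frac12$, $\bar\delta^h>0$, $\eta_k\in[0,1)$, $\delta^g_k\in(0,\bar\delta^g]$, $\delta^h_k\in(0,\bar\delta^h]$ ($k\ge 0$), and let $\widehat U_g,\widehat U_h>0$ be such that $\|\nabla f_i(x)\|\le\widehat U_g$ and $\|\nabla^2 f_i(x)\|\le\widehat U_h$ for all $i$ and all $x$ with $f(x)\le f(x_0)$ (Euclidean and spectral norm). Consider the following regularized Newton method, started at $x_0$. At iteration $k$, batches $\mathcal S_{g,k}$ and $\mathcal S_{h,k}$ of indices from $\{1,\dots,m\}$ are drawn uniformly at random (with or without replacement), independently of each other and of everything that happened before, with deterministic sizes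 $$|\mathcal S_{g,k}|\ge\frac{\widehat U_g^2\bigl(1+\sqrt{8\ln(1/\bar\delta)}\bigr)^2}{(\delta^g_k)^2\varepsilon^2},\qquad |\mathcal S_{h,k}|\ge\frac{16\,\widehat U_h^2}{(\delta^h_k)^2}\ln\frac{2n}{\bar\delta}.$$ One computes $$g_k=\frac1{|\mathcal S_{g,k}|}\sum_{i\in\mathcal S_{g,k}}\nabla f_i(x_k),\qquad Q_k=\frac1{|\mathcal S_{h,k}|}\sum_{i\in\mathcal S_{h,k}}\nabla^2 f_i(x_k),$$ $$c_k=\gamma\,\frac{L_g+\eta_k+2\delta^g_k\bigl(\frac{\eta_k}2+2L_g+2\delta^h_k\bigr)}{1-2\delta^g_k},\qquad H_k=Q_k+\bigl(\max\{-\lambda_{\min}(Q_k),0\}+c_k\bigr)I_n,$$ and sets $x_{k+1}=x_k+d_k$, where $d_k$ is any direction (possibly random) with $\|H_kd_k+g_k\|\le\frac{\eta_k}2\|d_k\|$. Put $$\tilde\beta_0=2L_g+2\bar\delta^h+\frac{\gamma\bigl(L_g+1+2\bar\delta^g(\frac12+2L_g+2\bar\delta^h)\bigr)}{1-2\bar\delta^g},\qquad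 \overline K_2=\left\lceil\frac{2\bigl(\frac32+\tilde\beta_0^2\bigr)(f(x_0)-f_*)}{(\gamma-1)L_g\varepsilon^2}\right\rceil.$$ Then, with probability at least $(1-\bar\delta)^{\overline K_2}$, there is $k\le\overline K_2$ with $\|\nabla f(x_k)\|\le 2\varepsilon$. Moreover, if $f(x_0)>f_*$, then with probability at least $(1-\bar\delta)^{\overline K_2}$ the first $k$ with $\|g_k\|\le\varepsilon$ exists, satisfies $k\le\overline K_2$, and $\|\nabla f(x_k)\|\le 2\varepsilon$; that is, the method with the stopping test $\|g_k\|\le\varepsilon$ terminates within $\overline K_2$ iterations at such a point. -/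

import Mathlib

open MeasureTheory ProbabilityTheory

noncomputable section

/-- Euclidean space of dimension `n`, with the Euclidean norm. -/
abbrev EucSp (n : ℕ) : Type := EuclideanSpace ℝ (Fin n)

/-- The finite-sum objective `f = (1/m) ∑ i, f_i`. -/
def finiteSum {n m : ℕ} (f : Fin m → EucSp n → ℝ) (x : EucSp n) : ℝ :=
  (1 / (m : ℝ)) * ∑ i, f i x

/-- The Hessian of `f` at `x`, as a linear operator; its norm is the spectral norm. -/
def hessian {n : ℕ} (f : EucSp n → ℝ) (x : EucSp n) : EucSp n →L[ℝ] EucSp n :=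
  fderiv ℝ (gradient f) x

/-- The minimal eigenvalue of a symmetric operator. -/
def lambdaMin {n : ℕ} (Q : EucSp n →L[ℝ] EucSp n) : ℝ :=
  sInf {a : ℝ | Module.End.HasEigenvalue (Q : EucSp n →ₗ[ℝ] EucSp n) a}

/-- The standing assumptions on the objective of an unconstrained problem: `f` is twice
continuously differentiable, its gradient is `L`-Lipschitz, and its level sets are bounded. -/
structure SmoothObjective {n : ℕ} (f : EucSp n → ℝ) (L : ℝ) : Prop where
  contDiff : ContDiff ℝ 2 f
  lipschitz : ∀ x y : EucSp n, ‖gradient f x - gradient f y‖ ≤ L * ‖x - y‖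
  boundedLevel : ∀ x₀ : EucSp n, Bornology.IsBounded {x | f x ≤ f x₀}

/-- The regularization parameter `c_k` of the method. -/
def regParam (γ L η δg δh : ℝ) : ℝ :=
  γ * ((L + η + 2 * δg * (η / 2 + 2 * L + 2 * δh)) / (1 - 2 * δg))

/-- The regularized operator `Q + ([-λ_min(Q)]₊ + c) I`. -/
def regHessian {n : ℕ} (Q : EucSp n →L[ℝ] EucSp n) (c : ℝ) : EucSp n →L[ℝ] EucSp n :=
  Q + (max (-lambdaMin Q) 0 + c) • ContinuousLinearMap.id ℝ (EucSp n)

/-- `x` is a sequence of iterates of the objective-evaluation-free regularized Newton method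
started at `x₀`, when `g k` and `Q k` are the approximate gradient and Hessian computed at
iteration `k`: `x (k+1) = x k + d` for some `d` with `‖H_k d + g_k‖ ≤ (η_k / 2) ‖d‖`. -/
structure IsRegNewtonRun {n : ℕ} (L γ : ℝ) (η δg δh : ℕ → ℝ) (x₀ : EucSp n)
    (g : ℕ → EucSp n) (Q : ℕ → EucSp n →L[ℝ] EucSp n) (x : ℕ → EucSp n) : Prop where
  init : x 0 = x₀
  step : ∀ k, ∃ d : EucSp n,
    ‖regHessian (Q k) (regParam γ L (η k) (δg k) (δh k)) d + g k‖ ≤ η k / 2 * ‖d‖ ∧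
      x (k + 1) = x k + d

/-- The subsampled gradient at `x` for the batch of indices `S 0, …, S (b - 1)`. -/
def subGradient {n m b : ℕ} (f : Fin m → EucSp n → ℝ) (S : Fin b → Fin m) (x : EucSp n) :
    EucSp n :=
  (1 / (b : ℝ)) • ∑ j, gradient (f (S j)) x

/-- The subsampled Hessian at `x` for the batch of indices `S 0, …, S (b - 1)`. -/
def subHessian {n m b : ℕ} (f : Fin m → EucSp n → ℝ) (S : Fin b → Fin m) (x : EucSp n) :
    EucSp n →L[ℝ] EucSp n :=
  (1 / (b : ℝ)) • ∑ j, hessian (f (S j)) x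

/-- The random batch `S` consists of `b` indices drawn uniformly at random from `m` indices,
with replacement (all sequences of length `b` are equally likely) or without replacement
(all sequences of `b` distinct indices are equally likely, so that the set of drawn indices is
a uniformly random subset of cardinality `b`). -/
def IsUniformBatch {Ω : Type*} [MeasurableSpace Ω] (μ : Measure Ω) {m b : ℕ}
    (S : Ω → Fin b → Fin m) : Prop :=
  μ.map S = uniformOn Set.univ ∨ μ.map S = uniformOn {s : Fin b → Fin m | Function.Injective s}

/-- The randomness of a subsampled method. `ℱ k` is the information available before the batches
of iteration `k` are drawn; these batches are uniform, independent of each other and independent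
of `ℱ k`. The next iterate may depend on all the information in `ℱ (k + 1)`, including further
randomness used by the solver of the subproblem. -/
structure IsSubsampling {Ω : Type*} [mΩ : MeasurableSpace Ω] (μ : Measure Ω)
    (ℱ : Filtration ℕ mΩ) {n m : ℕ} {bg bh : ℕ → ℕ}
    (Sg : (k : ℕ) → Ω → Fin (bg k) → Fin m) (Sh : (k : ℕ) → Ω → Fin (bh k) → Fin m)
    (x : ℕ → Ω → EucSp n) : Prop where
  measurable_iterate : ∀ k, Measurable[ℱ k] (x k)
  measurable_gradBatch : ∀ k, Measurable[ℱ (k + 1)] (Sg k)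
  measurable_hessBatch : ∀ k, Measurable[ℱ (k + 1)] (Sh k)
  uniform_gradBatch : ∀ k, IsUniformBatch μ (Sg k)
  uniform_hessBatch : ∀ k, IsUniformBatch μ (Sh k)
  indep_batches : ∀ k, IndepFun (Sg k) (Sh k) μ
  indep_past : ∀ k,
    Indep (MeasurableSpace.comap (fun ω => (Sg k ω, Sh k ω)) inferInstance) (ℱ k) μ

/-- The constant `β̃₀`, the upper bound of `2 L + 2 δ^h_k + c_k` over the admissible
`η_k ≤ 1`, `δ^g_k ≤ δgBar`, `δ^h_k ≤ δhBar`. -/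
def betaTilde (L γ δgBar δhBar : ℝ) : ℝ :=
  2 * L + 2 * δhBar +
    γ * (L + 1 + 2 * δgBar * (1 / 2 + 2 * L + 2 * δhBar)) / (1 - 2 * δgBar)

/-- The iteration bound `⌈2 (3/2 + β̃₀²) (f(x₀) - f_*) / ((γ - 1) L ε²)⌉`, where
`gap = f(x₀) - f_*`. -/
def iterBound (L γ δgBar δhBar gap ε : ℝ) : ℕ :=
  ⌈2 * (3 / 2 + betaTilde L γ δgBar δhBar ^ 2) * gap / ((γ - 1) * L * ε ^ 2)⌉₊

end

open scoped BigOperators InnerProductSpace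

/-! The argument separates a deterministic descent estimate from a probabilistic estimate of how
often the sampled derivatives are accurate.

Deterministic part. While `ε < ‖g‖`, the absolute gradient error `δg * ε` is also a relative error
`δg * ‖g‖`, and the inexact Newton equation bounds `‖g‖` by a multiple of `‖d‖`. Since the
regularized operator is at least `c I`, the descent lemma gives a decrease of at least `(γ - 1) L
‖d‖²`, and `‖d‖` is bounded below by a multiple of `ε`. Each step thus lowers the objective by more
than a fixed amount (`lt_sub_of_regNewton_step`). The iterates stay in the initial level set, and
`K` such steps would pass below the minimum (`exists_stopping_iteration`).

Probabilistic part. At a fixed point of the level set, the gradient batch fails with probability at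
most `δ⁴`: the norm of the centred sum has mean at most `U√b`, and its exponential moment is
controlled by bounded differences. The Hessian batch fails with probability at most `δ/2`: a
resampling argument bounds the even trace moments of the centred sum by Gaussian ones
(`expect_trace_pow_le`), hence its tail. Hoeffding's comparison (`expect_embedding_le_expect_pi`)
transfers both bounds to sampling without replacement. As new batches are independent of the past,
accuracy at the current random iterate costs a factor `1 - δ` per iteration
(`pow_le_measureReal_forall_lt`). -/

/-! ### Sampling with and without replacement. -/

theorem ConvexOn.map_expect_le {V κ : Type*} [AddCommGroup V] [Module ℝ V] [Fintype κ]
    [Nonempty κ] {C : Set V} {φ : V → ℝ} (hφ : ConvexOn ℝ C φ) (z : κ → V) (hz : ∀ i, z i ∈ C) :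
    φ ((Fintype.card κ : ℝ)⁻¹ • ∑ i, z i) ≤ 𝔼 i, φ (z i) := by
  have hc : (Fintype.card κ : ℝ) ≠ 0 := by exact_mod_cast Fintype.card_ne_zero
  have := hφ.map_sum_le (t := Finset.univ) (w := fun _ : κ => (Fintype.card κ : ℝ)⁻¹) (p := z)
    (fun _ _ => by positivity) (by simp [hc]) (fun i _ => hz i)
  rw [← Finset.smul_sum] at this
  refine this.trans_eq ?_
  rw [Fintype.expect_eq_sum_div_card, ← Finset.smul_sum, smul_eq_mul, div_eq_inv_mul]

/-- The image of `t` has at most `card ι` elements and can be enlarged to a set of exactly that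
size, which `ι` then indexes. This exhibits a sample with repetitions as a relabelling of one
without. -/
theorem exists_embedding_comp_eq {ι α : Type*} [Fintype ι] [Fintype α]
    (hc : Fintype.card ι ≤ Fintype.card α) (t : ι → α) :
    ∃ (e : ι ↪ α) (h : ι → ι), t = e ∘ h := by
  classical
  obtain ⟨R, hR, -, hRc⟩ := Finset.exists_subsuperset_card_eq
    (Finset.subset_univ (Finset.univ.image t)) (n := Fintype.card ι)
    Finset.card_image_le (by simpa using hc)
  let q : ι ≃ R := Fintype.equivOfCardEq (by simp [hRc])
  refine ⟨q.toEmbedding.trans (Function.Embedding.subtype _),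
    fun j => q.symm ⟨t j, hR (by simp)⟩, ?_⟩
  ext j
  simp

/-- Permutations of `α` act transitively on embeddings, so the left side does not depend on `e₀`;
averaging it over all embeddings and exchanging the averages gives the right side. -/
theorem expect_perm_comp_embedding {ι α : Type*} [Fintype ι] [Fintype α] [DecidableEq α]
    [DecidableEq ι] (e₀ : ι ↪ α) (G : (ι ↪ α) → ℝ) :
    𝔼 π : Equiv.Perm α, G (e₀.trans π.toEmbedding) = 𝔼 e, G e := by
  have : Nonempty (ι ↪ α) := ⟨e₀⟩
  have hconst (e : ι ↪ α) : 𝔼 π : Equiv.Perm α, G (e.trans π.toEmbedding)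
      = 𝔼 π : Equiv.Perm α, G (e₀.trans π.toEmbedding) := by
    obtain ⟨ρ, hρ⟩ := Equiv.Perm.exists_smul_eq_embedding e₀ e
    refine Fintype.expect_equiv (Equiv.mulRight ρ) _ _ fun π => ?_
    congr 1
    ext j
    rw [← hρ]
    rfl
  calc _ = 𝔼 e : ι ↪ α, 𝔼 π : Equiv.Perm α, G (e.trans π.toEmbedding) := by
        simp_rw [hconst, Fintype.expect_const]
    _ = 𝔼 π : Equiv.Perm α, 𝔼 e : ι ↪ α, G (e.trans π.toEmbedding) := Finset.expect_comm ..
    _ = 𝔼 _π : Equiv.Perm α, 𝔼 e : ι ↪ α, G e := by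
        refine Finset.expect_congr rfl fun π _ => ?_
        exact Fintype.expect_equiv (Equiv.embeddingCongr (Equiv.refl ι) π) _ _ fun e => by
          congr 1
    _ = _ := Fintype.expect_const _

theorem expect_perm_apply {ι : Type*} [Fintype ι] [DecidableEq ι] {V : Type*} [AddCommGroup V]
    [Module ℝ V] (y : ι → V) (i : ι) :
    (Fintype.card (Equiv.Perm ι) : ℝ)⁻¹ • ∑ σ : Equiv.Perm ι, y (σ i)
      = (Fintype.card ι : ℝ)⁻¹ • ∑ j, y j := by
  have : Nonempty ι := ⟨i⟩
  have hc : (Fintype.card ι : ℝ) ≠ 0 := by exact_mod_cast Fintype.card_ne_zero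
  have hconst (j : ι) : ∑ σ : Equiv.Perm ι, y (σ j) = ∑ σ : Equiv.Perm ι, y (σ i) :=
    Fintype.sum_equiv (Equiv.mulRight (Equiv.swap i j)) _ _ fun σ => by simp
  have h1 : ∑ j, ∑ σ : Equiv.Perm ι, y (σ j) = (Fintype.card ι : ℝ) • ∑ σ : Equiv.Perm ι, y (σ i) := by
    simp [hconst, Nat.cast_smul_eq_nsmul]
  have h2 : ∑ j, ∑ σ : Equiv.Perm ι, y (σ j) = (Fintype.card (Equiv.Perm ι) : ℝ) • ∑ j, y j := by
    rw [Finset.sum_comm]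
    simp_rw [fun σ : Equiv.Perm ι => Equiv.sum_comp σ y]
    simp [Nat.cast_smul_eq_nsmul]
  have hp : (Fintype.card (Equiv.Perm ι) : ℝ) ≠ 0 := by exact_mod_cast Fintype.card_ne_zero
  rw [inv_smul_eq_iff₀ hp, smul_comm, ← h2, h1, smul_smul, inv_mul_cancel₀ hc, one_smul]

/-- Hoeffding's comparison of sampling without and with replacement. -/
theorem expect_embedding_le_expect_pi {ι α V : Type*} [Fintype ι] [Fintype α] [DecidableEq α]
    [DecidableEq ι] [AddCommGroup V] [Module ℝ V] {C : Set V} {φ : V → ℝ}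
    (hφ : ConvexOn ℝ C φ) (X : α → V) (hX : ∀ t : ι → α, ∑ j, X (t j) ∈ C)
    (hc : Fintype.card ι ≤ Fintype.card α) :
    𝔼 e : ι ↪ α, φ (∑ j, X (e j)) ≤ 𝔼 t : ι → α, φ (∑ j, X (t j)) := by
  choose e h hth using exists_embedding_comp_eq (ι := ι) hc
  set F : (ι → α) → ℝ := fun t => φ (∑ j, X (t j)) with hF
  -- A random permutation of `α` leaves the law of `t` unchanged and turns the embedding in `t = e t
  -- ∘ h t` into a uniform one.
  have key : 𝔼 t : ι → α, F t = 𝔼 t : ι → α, 𝔼 u : ι ↪ α, F (u ∘ h t) := by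
    calc 𝔼 t : ι → α, F t = 𝔼 _π : Equiv.Perm α, 𝔼 t : ι → α, F t := (Fintype.expect_const _).symm
      _ = 𝔼 π : Equiv.Perm α, 𝔼 t : ι → α, F (π ∘ t) := by
          refine Finset.expect_congr rfl fun π _ => ?_
          exact (Fintype.expect_equiv (Equiv.arrowCongr (Equiv.refl ι) π) _ _ fun t => rfl).symm
      _ = 𝔼 t : ι → α, 𝔼 π : Equiv.Perm α, F (π ∘ t) := Finset.expect_comm ..
      _ = _ := by
          refine Finset.expect_congr rfl fun t _ => ?_
          rw [← expect_perm_comp_embedding (e t) fun u => F (u ∘ h t)]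
          refine Finset.expect_congr rfl fun π _ => ?_
          conv_lhs => rw [hth t]
          rfl
  rcases isEmpty_or_nonempty ι with hι | ⟨⟨i₀⟩⟩
  · have : Nonempty (ι ↪ α) := ⟨Function.Embedding.ofIsEmpty⟩
    simp [hF]
  have : Nonempty ι := ⟨i₀⟩
  have : Nonempty α := Fintype.card_pos_iff.1 (Fintype.card_pos.trans_le hc)
  rw [key, ← Fintype.expect_const (ι := ι → α) (𝔼 u : ι ↪ α, φ (∑ j, X (u j)))]
  refine Finset.expect_le_expect fun t _ => ?_
  have hswap : 𝔼 u : ι ↪ α, F (u ∘ h t)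
      = 𝔼 u : ι ↪ α, 𝔼 σ : Equiv.Perm ι, F (fun j => u (σ (h t j))) := by
    rw [Finset.expect_comm, ← Fintype.expect_const (ι := Equiv.Perm ι) (𝔼 u : ι ↪ α, F (u ∘ h t))]
    refine Finset.expect_congr rfl fun σ _ => ?_
    exact Fintype.expect_equiv (Equiv.embeddingCongr σ (Equiv.refl α)) _ _ fun u => by
      simp [Function.comp_def]
  rw [hswap]
  refine Finset.expect_le_expect fun u _ => ?_
  -- Jensen over `σ`: each `X (u (σ (h t j)))` averages to the mean of `X ∘ u`, whatever `h t j` is,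
  -- so the averaged sum is `∑ j, X (u j)`.
  refine le_trans (le_of_eq ?_) (hφ.map_expect_le
    (fun σ : Equiv.Perm ι => ∑ j, X (u (σ (h t j)))) fun σ => hX _)
  congr 1
  rw [Finset.sum_comm, Finset.smul_sum]
  simp_rw [expect_perm_apply (fun i => X (u i))]
  have hc' : (Fintype.card ι : ℝ) ≠ 0 := by exact_mod_cast Fintype.card_ne_zero
  rw [Finset.sum_const, Finset.card_univ, ← Nat.cast_smul_eq_nsmul ℝ, smul_smul,
    mul_inv_cancel₀ hc', one_smul]

/-! ### Trace inequalities for powers of symmetric operators. -/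

section TracePowers

variable {n : ℕ} {E : Type*} [NormedAddCommGroup E] [InnerProductSpace ℝ E]
  [FiniteDimensional ℝ E]

theorem LinearMap.IsSymmetric.pow_eigenvectorBasis {A : E →ₗ[ℝ] E} (hA : A.IsSymmetric)
    (hn : Module.finrank ℝ E = n) (i : Fin n) (q : ℕ) :
    (A ^ q) (hA.eigenvectorBasis hn i) = (hA.eigenvalues hn i) ^ q • hA.eigenvectorBasis hn i := by
  induction q with
  | zero => simp
  | succ q ih =>
    rw [pow_succ', Module.End.mul_apply, ih, map_smul, hA.apply_eigenvectorBasis, pow_succ,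
      smul_smul]
    rfl

/-- Expansion in the eigenbases of both `A` and `B`. The weights are nonnegative and independent of
`q` and `r`, so a scalar inequality between eigenvalues yields a trace inequality although `A` and
`B` need not commute. -/
theorem trace_mul_pow_mul_pow {A B H : E →ₗ[ℝ] E} (hA : A.IsSymmetric) (hB : B.IsSymmetric)
    (hH : H.IsSymmetric) (hn : Module.finrank ℝ E = n) (q r : ℕ) :
    LinearMap.trace ℝ E (H * A ^ q * H * B ^ r) = ∑ j, ∑ i,
      ⟪hA.eigenvectorBasis hn i, H (hB.eigenvectorBasis hn j)⟫_ℝ ^ 2 *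
        (hA.eigenvalues hn i ^ q * hB.eigenvalues hn j ^ r) := by
  rw [LinearMap.trace_eq_sum_inner _ (hB.eigenvectorBasis hn)]
  refine Finset.sum_congr rfl fun j _ => ?_
  simp only [Module.End.mul_apply, hB.pow_eigenvectorBasis, map_smul, inner_smul_right]
  rw [← hH, ← (hA.eigenvectorBasis hn).sum_inner_mul_inner, Finset.mul_sum]
  refine Finset.sum_congr rfl fun i _ => ?_
  rw [← hA.pow q (hA.eigenvectorBasis hn i), hA.pow_eigenvectorBasis, real_inner_smul_left,
    real_inner_comm]
  ring

theorem pow_tangent_le (a b : ℝ) (p : ℕ) :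
    b ^ (2 * p) + 2 * p * ((a - b) * b ^ (2 * p - 1)) ≤ a ^ (2 * p) := by
  rcases p with _ | p
  · simp
  have hconv : ConvexOn ℝ Set.univ fun x : ℝ => x ^ (2 * (p + 1)) :=
    Even.convexOn_pow (even_two_mul _)
  have hd : HasDerivAt (fun x : ℝ => x ^ (2 * (p + 1))) ((2 * (p + 1) : ℕ) * b ^ (2 * (p + 1) - 1)) b := by
    simpa using hasDerivAt_pow (2 * (p + 1)) b
  rcases lt_trichotomy a b with h | h | h
  · have := hconv.slope_le_of_hasDerivAt (Set.mem_univ a) (Set.mem_univ b) h hd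
    rw [slope_def_field, div_le_iff₀ (by linarith)] at this
    push_cast at this ⊢
    nlinarith
  · simp [h]
  · have := hconv.le_slope_of_hasDerivAt (Set.mem_univ b) (Set.mem_univ a) h hd
    rw [slope_def_field, le_div_iff₀ (by linarith)] at this
    push_cast at this ⊢
    nlinarith

/-- Klein's inequality for an even power: the scalar tangent inequality summed with the weights of
the double expansion for `H = 1`. -/
theorem trace_pow_tangent_le {A B : E →ₗ[ℝ] E} (hA : A.IsSymmetric) (hB : B.IsSymmetric) (p : ℕ) :
    LinearMap.trace ℝ E (B ^ (2 * p)) + 2 * p * LinearMap.trace ℝ E ((A - B) * B ^ (2 * p - 1))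
      ≤ LinearMap.trace ℝ E (A ^ (2 * p)) := by
  have h1 : (1 : E →ₗ[ℝ] E).IsSymmetric := LinearMap.IsSymmetric.id
  have F := trace_mul_pow_mul_pow hA hB h1 rfl
  rcases p with _ | p
  · simp
  have e1 := F 0 (2 * (p + 1))
  have e2 := F 1 (2 * (p + 1) - 1)
  have e3 := F 0 (2 * (p + 1) - 1 + 1)
  have e4 := F (2 * (p + 1)) 0
  simp only [one_mul, mul_one, pow_zero, pow_one] at e1 e2 e3 e4
  rw [sub_mul, map_sub, ← pow_succ', e1, e2, e3, e4, ← Finset.sum_sub_distrib, Finset.mul_sum,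
    ← Finset.sum_add_distrib]
  refine Finset.sum_le_sum fun j _ => ?_
  rw [← Finset.sum_sub_distrib, Finset.mul_sum, ← Finset.sum_add_distrib]
  refine Finset.sum_le_sum fun i _ => ?_
  have := mul_le_mul_of_nonneg_left
    (pow_tangent_le (hA.eigenvalues rfl i) (hB.eigenvalues rfl j) (p + 1))
    (sq_nonneg ⟪hA.eigenvectorBasis rfl i, (1 : E →ₗ[ℝ] E) (hB.eigenvectorBasis rfl j)⟫_ℝ)
  refine le_trans (le_of_eq ?_) this
  rw [pow_succ]
  ring

theorem convexOn_trace_pow (p : ℕ) :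
    ConvexOn ℝ {A : E →ₗ[ℝ] E | A.IsSymmetric} fun A => LinearMap.trace ℝ E (A ^ (2 * p)) := by
  have hC : Convex ℝ {A : E →ₗ[ℝ] E | A.IsSymmetric} := fun A hA B hB a b _ _ _ =>
    (LinearMap.IsSymmetric.smul (by simp) hA).add (LinearMap.IsSymmetric.smul (by simp) hB)
  refine ⟨hC, fun A hA B hB a b ha hb hab => ?_⟩
  have hM := hC hA hB ha hb hab
  set M := a • A + b • B with hMdef
  have h1 := mul_le_mul_of_nonneg_left (trace_pow_tangent_le hA hM p) ha
  have h2 := mul_le_mul_of_nonneg_left (trace_pow_tangent_le hB hM p) hb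
  -- With both tangents taken at the convex combination `M`, the first-order terms cancel.
  have h3 : a * LinearMap.trace ℝ E ((A - M) * M ^ (2 * p - 1))
      + b * LinearMap.trace ℝ E ((B - M) * M ^ (2 * p - 1)) = 0 := by
    have h0 : a • (A - M) + b • (B - M) = 0 := by
      rw [smul_sub, smul_sub, sub_add_sub_comm, ← add_smul, hab, one_smul, ← hMdef, sub_self]
    have := congrArg (fun Z => LinearMap.trace ℝ E (Z * M ^ (2 * p - 1))) h0
    simpa only [add_mul, smul_mul_assoc, map_add, map_smul, smul_eq_mul, zero_mul, map_zero]
      using this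
  have h4 : a * LinearMap.trace ℝ E (M ^ (2 * p)) + b * LinearMap.trace ℝ E (M ^ (2 * p))
      = LinearMap.trace ℝ E (M ^ (2 * p)) := by rw [← add_mul, hab, one_mul]
  simp only [smul_eq_mul]
  linear_combination h1 + h2 - h4 - 2 * p * h3

theorem abs_pow_mul_pow_add_le (a b : ℝ) (q r : ℕ) (h : Even (q + r)) :
    a ^ q * b ^ r + a ^ r * b ^ q ≤ a ^ (q + r) + b ^ (q + r) := by
  have h1 : a ^ q * b ^ r + a ^ r * b ^ q ≤ |a| ^ q * |b| ^ r + |a| ^ r * |b| ^ q :=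
    add_le_add ((le_abs_self _).trans_eq (by simp [abs_mul, abs_pow]))
      ((le_abs_self _).trans_eq (by simp [abs_mul, abs_pow]))
  -- Both factors have the same sign. Evenness of `q + r` is what removes the absolute values on the
  -- right-hand side.
  have h2 : 0 ≤ (|a| ^ q - |b| ^ q) * (|a| ^ r - |b| ^ r) := by
    rcases le_total |a| |b| with hab | hab
    · exact mul_nonneg_of_nonpos_of_nonpos
        (sub_nonpos.2 (pow_le_pow_left₀ (abs_nonneg _) hab _))
        (sub_nonpos.2 (pow_le_pow_left₀ (abs_nonneg _) hab _))
    · exact mul_nonneg (sub_nonneg.2 (pow_le_pow_left₀ (abs_nonneg _) hab _))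
        (sub_nonneg.2 (pow_le_pow_left₀ (abs_nonneg _) hab _))
  rw [← h.pow_abs a, ← h.pow_abs b, pow_add, pow_add]
  nlinarith

theorem trace_sandwich_add_le {A B H : E →ₗ[ℝ] E} (hA : A.IsSymmetric) (hB : B.IsSymmetric)
    (hH : H.IsSymmetric) (q r : ℕ) (h : Even (q + r)) :
    LinearMap.trace ℝ E (H * A ^ q * H * B ^ r) + LinearMap.trace ℝ E (H * A ^ r * H * B ^ q)
      ≤ LinearMap.trace ℝ E (H ^ 2 * A ^ (q + r)) + LinearMap.trace ℝ E (H ^ 2 * B ^ (q + r)) := by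
  have F := trace_mul_pow_mul_pow hA hB hH rfl
  have e3 := F (q + r) 0
  have e4 := F 0 (q + r)
  rw [pow_zero, mul_one, LinearMap.trace_mul_comm, ← mul_assoc, ← sq] at e3
  rw [pow_zero, mul_one, ← sq] at e4
  rw [F q r, F r q, e3, e4, ← Finset.sum_add_distrib, ← Finset.sum_add_distrib]
  refine Finset.sum_le_sum fun j _ => ?_
  rw [← Finset.sum_add_distrib, ← Finset.sum_add_distrib]
  refine Finset.sum_le_sum fun i _ => ?_
  rw [← mul_add, ← mul_add]
  refine mul_le_mul_of_nonneg_left ?_ (sq_nonneg _)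
  simpa using abs_pow_mul_pow_add_le (hA.eigenvalues rfl i) (hB.eigenvalues rfl j) q r h

theorem pow_sub_pow_eq_sum {R : Type*} [Ring R] (A B : R) (N : ℕ) :
    A ^ N - B ^ N = ∑ q ∈ Finset.range N, A ^ q * (A - B) * B ^ (N - 1 - q) := by
  induction N with
  | zero => simp
  | succ N ih =>
    have : A ^ (N + 1) - B ^ (N + 1) = (A ^ N - B ^ N) * B + A ^ N * (A - B) := by
      rw [pow_succ, pow_succ]; noncomm_ring
    rw [this, ih, Finset.sum_range_succ, Finset.sum_mul]
    congr 1
    · refine Finset.sum_congr rfl fun q hq => ?_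
      have : N + 1 - 1 - q = N - 1 - q + 1 := by have := Finset.mem_range.1 hq; omega
      rw [this, pow_succ]
      simp only [mul_assoc]
    · simp

/-- Telescoping the difference of powers gives `2 * p + 1` terms; the term with index `q` is paired
with its reflection `2 * p - q`, and each pair is bounded by the sandwich inequality. -/
theorem trace_sub_mul_pow_sub_pow_le {A B : E →ₗ[ℝ] E} (hA : A.IsSymmetric) (hB : B.IsSymmetric)
    (p : ℕ) :
    2 * LinearMap.trace ℝ E ((A - B) * (A ^ (2 * p + 1) - B ^ (2 * p + 1)))
      ≤ (2 * p + 1) * (LinearMap.trace ℝ E ((A - B) ^ 2 * A ^ (2 * p))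
        + LinearMap.trace ℝ E ((A - B) ^ 2 * B ^ (2 * p))) := by
  have hH := hA.sub hB
  rw [pow_sub_pow_eq_sum, Finset.mul_sum, map_sum]
  simp only [← mul_assoc, Nat.add_sub_cancel]
  have hrefl := Finset.sum_range_reflect
    (fun q => LinearMap.trace ℝ E ((A - B) * A ^ q * (A - B) * B ^ (2 * p - q))) (2 * p + 1)
  rw [two_mul]
  nth_rewrite 1 [← hrefl]
  rw [← Finset.sum_add_distrib]
  refine (Finset.sum_le_card_nsmul _ _ _ fun q hq => ?_).trans_eq
    (b := (Finset.range (2 * p + 1)).card • (LinearMap.trace ℝ E ((A - B) ^ 2 * A ^ (2 * p))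
        + LinearMap.trace ℝ E ((A - B) ^ 2 * B ^ (2 * p)))) ?_
  · have hq' := Finset.mem_range.1 hq
    have e1 : 2 * p + 1 - 1 - q = 2 * p - q := by omega
    have e2 : 2 * p - (2 * p - q) = q := by omega
    have e3 : 2 * p - q + q = 2 * p := by omega
    have := trace_sandwich_add_le hA hB hH (2 * p - q) q (by rw [e3]; exact even_two_mul p)
    rw [e3] at this
    rw [e1, e2]
    exact this
  · rw [Finset.card_range, nsmul_eq_mul]
    push_cast
    ring

theorem trace_sq_mul_pow_le {A H : E →ₗ[ℝ] E} (hA : A.IsSymmetric) (hH : H.IsSymmetric)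
    {c : ℝ} (hc : ∀ v, ‖H v‖ ≤ c * ‖v‖) (p : ℕ) :
    LinearMap.trace ℝ E (H ^ 2 * A ^ (2 * p)) ≤ c ^ 2 * LinearMap.trace ℝ E (A ^ (2 * p)) := by
  rw [LinearMap.trace_eq_sum_inner _ (hA.eigenvectorBasis rfl),
    LinearMap.trace_eq_sum_inner _ (hA.eigenvectorBasis rfl), Finset.mul_sum]
  refine Finset.sum_le_sum fun i _ => ?_
  rw [Module.End.mul_apply, hA.pow_eigenvectorBasis, map_smul, inner_smul_right, inner_smul_right,
    sq H, Module.End.mul_apply, ← hH, real_inner_self_eq_norm_sq, real_inner_self_eq_norm_sq]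
  have h1 := hc (hA.eigenvectorBasis rfl i)
  have h2 : ‖hA.eigenvectorBasis rfl i‖ = 1 := (hA.eigenvectorBasis rfl).norm_eq_one i
  have h3 : 0 ≤ hA.eigenvalues rfl i ^ (2 * p) := (even_two_mul p).pow_nonneg _
  rw [h2, mul_one] at h1
  rw [h2, one_pow, mul_one]
  have := pow_le_pow_left₀ (norm_nonneg _) h1 2
  nlinarith

theorem trace_pow_eq_sum {A : E →ₗ[ℝ] E} (hA : A.IsSymmetric) (q : ℕ) :
    LinearMap.trace ℝ E (A ^ q) = ∑ i, hA.eigenvalues rfl i ^ q := by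
  rw [LinearMap.trace_eq_sum_inner _ (hA.eigenvectorBasis rfl)]
  refine Finset.sum_congr rfl fun i _ => ?_
  rw [hA.pow_eigenvectorBasis, inner_smul_right, real_inner_self_eq_norm_sq,
      (hA.eigenvectorBasis rfl).norm_eq_one]
  simp

theorem trace_even_pow_nonneg {A : E →ₗ[ℝ] E} (hA : A.IsSymmetric) (p : ℕ) :
    0 ≤ LinearMap.trace ℝ E (A ^ (2 * p)) := by
  rw [trace_pow_eq_sum hA]
  exact Finset.sum_nonneg fun i _ => (even_two_mul p).pow_nonneg _

theorem norm_pow_le_trace {A : E →ₗ[ℝ] E} (hA : A.IsSymmetric) {c : ℝ} (hc : 0 ≤ c)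
    {v : E} (hv : c * ‖v‖ < ‖A v‖) (p : ℕ) :
    c ^ (2 * p) ≤ LinearMap.trace ℝ E (A ^ (2 * p)) := by
  obtain ⟨i, hi⟩ : ∃ i, c ≤ |hA.eigenvalues rfl i| := by
    by_contra! hlt
    refine absurd hv (not_lt.2 ?_)
    refine le_of_sq_le_sq ?_ (by positivity)
    rw [mul_pow, ← (hA.eigenvectorBasis rfl).sum_sq_norm_inner_right (A v),
      ← (hA.eigenvectorBasis rfl).sum_sq_norm_inner_right v, Finset.mul_sum]
    refine Finset.sum_le_sum fun i _ => ?_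
    rw [← hA, hA.apply_eigenvectorBasis, real_inner_smul_left, norm_mul, mul_pow]
    refine mul_le_mul_of_nonneg_right ?_ (sq_nonneg _)
    exact pow_le_pow_left₀ (norm_nonneg _) (hlt i).le 2
  rw [trace_pow_eq_sum hA]
  refine le_trans ?_ (Finset.single_le_sum (fun j _ => (even_two_mul p).pow_nonneg _)
    (Finset.mem_univ i))
  rw [← (even_two_mul p).pow_abs (hA.eigenvalues rfl i)]
  exact pow_le_pow_left₀ hc hi _

end TracePowers

/-! ### Trace moments of sums of independent symmetric operators. -/

/-- A sample and the sample with its `j`-th entry redrawn form an exchangeable pair: exchanging the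
entry with its replacement is an involution. -/
theorem expect_update_swap {ι α : Type*} [Fintype ι] [DecidableEq ι] [Fintype α] [DecidableEq α]
    (j : ι) (F : (ι → α) → α → ℝ) :
    𝔼 t, 𝔼 a, F (Function.update t j a) (t j) = 𝔼 t, 𝔼 a, F t a := by
  have hinv : Function.Involutive
      fun z : (ι → α) × α => (Function.update z.1 j z.2, z.1 j) := fun z => by simp
  rw [← Finset.expect_product', ← Finset.expect_product', Finset.univ_product_univ]
  exact Fintype.expect_equiv hinv.toPerm _ _ fun z => rfl

section MatrixMoments

variable {ι α E : Type*} [Fintype ι] [DecidableEq ι] [Fintype α] [DecidableEq α] [Nonempty α]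
  [NormedAddCommGroup E] [InnerProductSpace ℝ E] [FiniteDimensional ℝ E]

/-- Method of exchangeable pairs. As `Y` has mean zero, `Y (t j)` may be replaced by its difference
with a fresh `Y a`, which equals the difference of the two sums. Symmetrizing then gives half of the
trace `(S - S')(S ^ (2 * p + 1) - S' ^ (2 * p + 1))`, which involves only lower moments. -/
theorem expect_trace_apply_mul_pow_le {Y : α → E →ₗ[ℝ] E} (hY : ∀ a, (Y a).IsSymmetric)
    (h0 : ∑ a, Y a = 0) {c : ℝ} (hc : ∀ a b v, ‖(Y a - Y b) v‖ ≤ c * ‖v‖) (p : ℕ) (j : ι) :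
    𝔼 t : ι → α, LinearMap.trace ℝ E (Y (t j) * (∑ i, Y (t i)) ^ (2 * p + 1))
      ≤ (2 * p + 1) * (c ^ 2 / 2) *
        𝔼 t : ι → α, LinearMap.trace ℝ E ((∑ i, Y (t i)) ^ (2 * p)) := by
  set S : (ι → α) → E →ₗ[ℝ] E := fun t => ∑ i, Y (t i) with hS
  set tr := LinearMap.trace ℝ E
  have hSs (t : ι → α) : (S t).IsSymmetric := by
    refine Finset.sum_induction _ LinearMap.IsSymmetric (fun _ _ => LinearMap.IsSymmetric.add)
      LinearMap.IsSymmetric.zero fun i _ => hY _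
  have hupd (t : ι → α) (a : α) : S t - S (Function.update t j a) = Y (t j) - Y a := by
    simp only [hS, ← Finset.sum_sub_distrib]
    rw [Finset.sum_eq_single j]
    · simp
    · intro i _ hi
      simp [Function.update_of_ne hi]
    · simp
  set F : (ι → α) → α → ℝ := fun t a => tr ((Y (t j) - Y a) * S t ^ (2 * p + 1)) with hF
  have h1 : 𝔼 t, tr (Y (t j) * S t ^ (2 * p + 1)) = 𝔼 t, 𝔼 a, F t a := by
    refine Finset.expect_congr rfl fun t _ => ?_
    simp only [hF, sub_mul, map_sub, Finset.expect_sub_distrib, Fintype.expect_const]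
    rw [Fintype.expect_eq_sum_div_card fun a => tr (Y a * S t ^ (2 * p + 1)), ← map_sum,
      ← Finset.sum_mul, h0]
    simp
  have h2 : 2 * 𝔼 t, 𝔼 a, F t a
      = 𝔼 t : ι → α, 𝔼 a, (F t a + F (Function.update t j a) (t j)) := by
    simp only [Finset.expect_add_distrib]
    rw [expect_update_swap j F, two_mul]
  have h3 (t : ι → α) (a : α) : F t a + F (Function.update t j a) (t j)
      ≤ (2 * p + 1) * (c ^ 2 / 2) * (tr (S t ^ (2 * p)) + tr (S (Function.update t j a) ^ (2 * p))) := by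
    have hk := trace_sub_mul_pow_sub_pow_le (hSs t) (hSs (Function.update t j a)) p
    have hb (v : E) : ‖(S t - S (Function.update t j a)) v‖ ≤ c * ‖v‖ := by
      rw [hupd]; exact hc _ _ v
    have hΔ := (hSs t).sub (hSs (Function.update t j a))
    have hk1 := trace_sq_mul_pow_le (hSs t) hΔ hb p
    have hk2 := trace_sq_mul_pow_le (hSs (Function.update t j a)) hΔ hb p
    have e : F t a + F (Function.update t j a) (t j) = tr ((S t - S (Function.update t j a)) *
        (S t ^ (2 * p + 1) - S (Function.update t j a) ^ (2 * p + 1))) := by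
      rw [hupd, mul_sub, map_sub]
      simp only [hF, Function.update_self]
      rw [← neg_sub (Y (t j)) (Y a), neg_mul, map_neg]
      ring
    have hp : (0 : ℝ) ≤ 2 * p + 1 := by positivity
    have := mul_le_mul_of_nonneg_left (add_le_add hk1 hk2) hp
    rw [e]
    linarith
  have h4 : 𝔼 t : ι → α, 𝔼 a, (tr (S t ^ (2 * p)) + tr (S (Function.update t j a) ^ (2 * p)))
      = 2 * 𝔼 t, tr (S t ^ (2 * p)) := by
    simp only [Finset.expect_add_distrib, Fintype.expect_const]
    rw [expect_update_swap j fun t _ => tr (S t ^ (2 * p))]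
    simp only [Fintype.expect_const]
    ring
  have h5 := Finset.expect_le_expect (s := Finset.univ) fun (t : ι → α) _ =>
    Finset.expect_le_expect (s := Finset.univ) fun (a : α) _ => h3 t a
  simp only [← Finset.mul_expect] at h5
  rw [h4, ← h2] at h5
  rw [h1]
  linarith

/-- Iterating the moment recursion produces the double factorials `(2 * p - 1)!!`, that is, Gaussian
moments with variance `card ι * c ^ 2 / 2`. -/
theorem expect_trace_pow_le {Y : α → E →ₗ[ℝ] E} (hY : ∀ a, (Y a).IsSymmetric)
    (h0 : ∑ a, Y a = 0) {c : ℝ} (hc : ∀ a b v, ‖(Y a - Y b) v‖ ≤ c * ‖v‖) (p : ℕ) :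
    𝔼 t : ι → α, LinearMap.trace ℝ E ((∑ i, Y (t i)) ^ (2 * p))
      ≤ Module.finrank ℝ E * ((2 * p).factorial / (2 ^ p * p.factorial)) *
        (Fintype.card ι * (c ^ 2 / 2)) ^ p := by
  induction p with
  | zero => simp
  | succ p ih =>
    have h1 : 𝔼 t : ι → α, LinearMap.trace ℝ E ((∑ i, Y (t i)) ^ (2 * (p + 1)))
        = ∑ j, 𝔼 t : ι → α, LinearMap.trace ℝ E (Y (t j) * (∑ i, Y (t i)) ^ (2 * p + 1)) := by
      rw [← Finset.expect_sum_comm]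
      refine Finset.expect_congr rfl fun t _ => ?_
      rw [← map_sum, ← Finset.sum_mul, ← pow_succ']
      rfl
    rw [h1]
    refine (Finset.sum_le_card_nsmul _ _ _
      fun j _ => expect_trace_apply_mul_pow_le hY h0 hc p j).trans ?_
    rw [Finset.card_univ, nsmul_eq_mul]
    have hf : ((2 * (p + 1)).factorial : ℝ) / (2 ^ (p + 1) * (p + 1).factorial)
        = (2 * p + 1) * ((2 * p).factorial / (2 ^ p * p.factorial)) := by
      rw [show 2 * (p + 1) = 2 * p + 1 + 1 by ring, Nat.factorial_succ, Nat.factorial_succ,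
        Nat.factorial_succ]
      have := p.factorial_ne_zero
      push_cast
      field_simp
      ring
    rw [hf, pow_succ ((Fintype.card ι : ℝ) * (c ^ 2 / 2)) p]
    have := mul_le_mul_of_nonneg_left ih
      (by positivity : 0 ≤ (Fintype.card ι : ℝ) * ((2 * p + 1) * (c ^ 2 / 2)))
    linarith

end MatrixMoments

/-! ### From moments to tails, and Markov's inequality for batches. -/

/-- A probability whose product with the even powers of `r` is bounded by Gaussian moments has a
Gaussian tail. -/
theorem le_exp_of_forall_pow_mul_le {P r d σ : ℝ} (hP : 0 ≤ P) (hσ : 0 < σ)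
    (h : ∀ p : ℕ, r ^ (2 * p) * P ≤ d * ((2 * p).factorial / (2 ^ p * p.factorial)) * σ ^ p) :
    P ≤ 2 * d * Real.exp (-(r ^ 2 / (2 * σ))) := by
  -- The hypotheses are weighted by `θ ^ (2 * p) / (2 * p)!` and summed: `cosh (θ r) P ≤ d exp (θ² σ
  -- / 2)`. This `θ` minimizes `θ² σ / 2 - θ r`; the factor `2` comes from `exp / 2 ≤ cosh`.
  obtain ⟨θ, hθ⟩ : ∃ θ, θ = r / σ := ⟨_, rfl⟩
  have hc : HasSum (fun p : ℕ => (θ * r) ^ (2 * p) / (2 * p).factorial * P)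
      (Real.cosh (θ * r) * P) := (Real.hasSum_cosh (θ * r)).mul_right P
  have he : HasSum (fun p : ℕ => d * ((θ ^ 2 * σ / 2) ^ p / p.factorial))
      (d * Real.exp (θ ^ 2 * σ / 2)) := by
    have := NormedSpace.expSeries_div_hasSum_exp (θ ^ 2 * σ / 2)
    rw [← Real.exp_eq_exp_ℝ] at this
    exact this.mul_left d
  have hle : Real.cosh (θ * r) * P ≤ d * Real.exp (θ ^ 2 * σ / 2) := by
    refine hasSum_le (fun p => ?_) hc he
    have hpos : (0 : ℝ) < (2 * p).factorial := by positivity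
    have hpos' : (0 : ℝ) < p.factorial := by positivity
    have := mul_le_mul_of_nonneg_left (h p)
      (div_nonneg ((even_two_mul p).pow_nonneg θ) hpos.le)
    refine le_trans (le_of_eq ?_) (this.trans_eq ?_)
    · rw [mul_pow]; ring
    · rw [div_pow (θ ^ 2 * σ), mul_pow, ← pow_mul]
      field_simp
  have e1 : θ * r = r ^ 2 / σ := by rw [hθ]; ring
  have e2 : θ ^ 2 * σ / 2 = r ^ 2 / (2 * σ) := by rw [hθ]; field_simp
  have hcosh : Real.exp (r ^ 2 / σ) / 2 ≤ Real.cosh (θ * r) := by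
    rw [e1, Real.cosh_eq]
    have := (Real.exp_pos (-(r ^ 2 / σ))).le
    linarith
  have h2 := (mul_le_mul_of_nonneg_right hcosh hP).trans hle
  rw [e2] at h2
  have h3 : Real.exp (r ^ 2 / (2 * σ)) = Real.exp (r ^ 2 / σ) * Real.exp (-(r ^ 2 / (2 * σ))) := by
    rw [← Real.exp_add]
    congr 1
    field_simp
    ring
  rw [h3] at h2
  have hpos := Real.exp_pos (r ^ 2 / σ)
  refine le_of_mul_le_mul_left ?_ hpos
  linarith

/-- Markov's inequality for a convex functional of the sum. Convexity allows the bound to be stated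
for sampling with replacement in both cases. -/
theorem IsUniformBatch.mul_measureReal_le {Ω : Type*} [MeasurableSpace Ω] {μ : Measure Ω}
    [IsProbabilityMeasure μ] {m b : ℕ} {S : Ω → Fin b → Fin m} (hS : IsUniformBatch μ S)
    (hSm : Measurable S) {V : Type*} [AddCommGroup V] [Module ℝ V] {C : Set V} {φ : V → ℝ}
    (hφ : ConvexOn ℝ C φ) (X : Fin m → V) (hX : ∀ t : Fin b → Fin m, ∑ j, X (t j) ∈ C)
    (h0 : ∀ t : Fin b → Fin m, 0 ≤ φ (∑ j, X (t j))) {T : Set (Fin b → Fin m)} {r : ℝ}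
    (hT : ∀ t ∈ T, r ≤ φ (∑ j, X (t j))) :
    r * μ.real (S ⁻¹' T) ≤ 𝔼 t : Fin b → Fin m, φ (∑ j, X (t j)) := by
  classical
  have hmeas : μ.real (S ⁻¹' T) = (μ.map S).real T :=
    (map_measureReal_apply hSm (MeasurableSet.of_discrete)).symm
  have key (A : Finset (Fin b → Fin m)) (hA : μ.map S = uniformOn (A : Set (Fin b → Fin m))) :
      r * μ.real (S ⁻¹' T) ≤ 𝔼 t ∈ A, φ (∑ j, X (t j)) := by
    have e : μ.real (S ⁻¹' T) = ((A ∩ T.toFinset).card : ℝ) / A.card := by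
      rw [hmeas, hA, measureReal_def, ← Set.coe_toFinset T, uniformOn_apply_finset]
      simp
    rw [e, Finset.expect_eq_sum_div_card, mul_div_assoc']
    gcongr
    calc r * ((A ∩ T.toFinset).card : ℝ) = ∑ t ∈ A ∩ T.toFinset, r := by
          rw [Finset.sum_const, nsmul_eq_mul, mul_comm]
      _ ≤ ∑ t ∈ A ∩ T.toFinset, φ (∑ j, X (t j)) :=
          Finset.sum_le_sum fun t ht => hT t (by simpa using (Finset.mem_inter.1 ht).2)
      _ ≤ ∑ t ∈ A, φ (∑ j, X (t j)) :=
          Finset.sum_le_sum_of_subset_of_nonneg Finset.inter_subset_left fun t _ _ => h0 t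
  rcases hS with hu | hu
  · exact key Finset.univ (by simpa using hu)
  -- `uniformOn ∅` is the zero measure, which is not the law of `S`; hence `b ≤ m`, as the
  -- comparison requires.
  · have hne : ∃ s : Fin b → Fin m, Function.Injective s := by
      by_contra! hne
      have hemp : {s : Fin b → Fin m | Function.Injective s} = ∅ :=
        Set.eq_empty_of_forall_notMem hne
      have : IsProbabilityMeasure (μ.map S) := Measure.isProbabilityMeasure_map hSm.aemeasurable
      rw [hemp, uniformOn_empty_meas] at hu
      exact IsProbabilityMeasure.ne_zero _ hu
    obtain ⟨s, hs⟩ := hne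
    refine (key (Finset.univ.filter Function.Injective) (by simpa using hu)).trans ?_
    refine le_trans (le_of_eq ?_) (expect_embedding_le_expect_pi hφ X hX
      (Fintype.card_le_of_injective s hs))
    symm
    refine Finset.expect_nbij (fun e : Fin b ↪ Fin m => ⇑e) (by simp [Function.Embedding.injective])
      (fun _ _ => rfl) (fun e _ e' _ h => DFunLike.coe_injective h) fun t ht => ?_
    exact ⟨⟨t, by simpa using ht⟩, by simp, rfl⟩

/-! ### Bounded differences and norms of sums in inner product spaces. -/

theorem expect_exp_le_of_sub_le {α : Type*} [Fintype α] [Nonempty α] (z : α → ℝ) {c : ℝ}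
    (hc : ∀ a b, z a - z b ≤ c) (θ : ℝ) :
    𝔼 a, Real.exp (θ * z a) ≤ Real.exp (θ * 𝔼 a, z a + θ ^ 2 * c ^ 2 / 8) := by
  let _ : MeasurableSpace α := ⊤
  have hint (F : α → ℝ) : ∫ a, F a ∂(PMF.uniformOfFintype α).toMeasure = 𝔼 a, F a := by
    rw [PMF.integral_eq_sum, Fintype.expect_eq_sum_div_card, Finset.sum_div]
    simp [div_eq_inv_mul]
  obtain ⟨a₀, ha₀⟩ := Finite.exists_min z
  have hc0 : 0 ≤ c := by simpa using hc a₀ a₀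
  have hsub := hasSubgaussianMGF_of_mem_Icc (μ := (PMF.uniformOfFintype α).toMeasure) (X := z)
    (a := z a₀) (b := z a₀ + c) (Measurable.of_discrete.aemeasurable)
    (Filter.Eventually.of_forall fun a => ⟨ha₀ a, by linarith [hc a a₀]⟩)
  have h := hsub.mgf_le θ
  rw [mgf, hint, hint] at h
  simp only [mul_sub, Real.exp_sub, ← Finset.expect_div] at h
  rw [div_le_iff₀ (Real.exp_pos _), ← Real.exp_add] at h
  refine h.trans_eq ?_
  congr 1
  simp only [add_sub_cancel_left]
  push_cast
  rw [Real.norm_of_nonneg hc0]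
  ring

theorem expect_pi_succ {α : Type*} [Fintype α] {b : ℕ} (F : (Fin (b + 1) → α) → ℝ) :
    𝔼 t, F t = 𝔼 a, 𝔼 s : Fin b → α, F (Fin.cons a s) := by
  rw [← Finset.expect_product', Finset.univ_product_univ]
  exact (Fintype.expect_equiv (Fin.consEquiv fun _ => α) _ _ fun z => rfl).symm

/-- The moment generating function bound behind McDiarmid's inequality. -/
theorem expect_exp_le_of_bounded_differences {α : Type*} [Fintype α] [Nonempty α] {b : ℕ}
    (Φ : (Fin b → α) → ℝ) {c : ℝ}
    (hc : ∀ t j a, Φ t - Φ (Function.update t j a) ≤ c) (θ : ℝ) :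
    𝔼 t, Real.exp (θ * Φ t) ≤ Real.exp (θ * 𝔼 t, Φ t + b * (θ ^ 2 * c ^ 2 / 8)) := by
  induction b with
  | zero => simp
  | succ b ih =>
    -- The conditional mean given the first coordinate inherits the difference bound `c`, so
    -- Hoeffding's lemma applies to it and the induction hypothesis to the rest.
    set ψ : α → ℝ := fun a => 𝔼 s : Fin b → α, Φ (Fin.cons a s) with hψ
    have h1 (a : α) : 𝔼 s : Fin b → α, Real.exp (θ * Φ (Fin.cons a s))
        ≤ Real.exp (b * (θ ^ 2 * c ^ 2 / 8)) * Real.exp (θ * ψ a) := by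
      refine (ih (fun s => Φ (Fin.cons a s)) fun s j a' => ?_).trans_eq ?_
      · rw [Fin.cons_update]
        exact hc _ _ _
      · rw [← Real.exp_add, add_comm]
    have h2 (a a' : α) : ψ a - ψ a' ≤ c := by
      rw [hψ, ← Finset.expect_sub_distrib, ← Fintype.expect_const (ι := Fin b → α) c]
      refine Finset.expect_le_expect fun s _ => ?_
      have := hc (Fin.cons a s) 0 a'
      rwa [Fin.update_cons_zero] at this
    rw [expect_pi_succ, expect_pi_succ]
    refine (Finset.expect_le_expect fun a _ => h1 a).trans ?_
    rw [← Finset.mul_expect]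
    refine (mul_le_mul_of_nonneg_left (expect_exp_le_of_sub_le ψ h2 θ)
      (Real.exp_pos _).le).trans_eq ?_
    rw [← Real.exp_add]
    congr 1
    push_cast
    ring

section HilbertSums

variable {α H : Type*} [Fintype α] [Nonempty α] [NormedAddCommGroup H] [InnerProductSpace ℝ H]

theorem expect_norm_sum_sq {Y : α → H} (h0 : ∑ a, Y a = 0) (b : ℕ) :
    𝔼 t : Fin b → α, ‖∑ j, Y (t j)‖ ^ 2 = b * 𝔼 a, ‖Y a‖ ^ 2 := by
  induction b with
  | zero => simp
  | succ b ih =>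
    rw [expect_pi_succ]
    simp only [Fin.sum_univ_succ, Fin.cons_zero, Fin.cons_succ]
    simp_rw [norm_add_sq_real, Finset.expect_add_distrib, Fintype.expect_const]
    have hz : 𝔼 a, 𝔼 s : Fin b → α, 2 * ⟪Y a, ∑ j, Y (s j)⟫_ℝ = 0 := by
      rw [Finset.expect_comm]
      refine Finset.expect_eq_zero fun s _ => ?_
      rw [Fintype.expect_eq_sum_div_card, ← Finset.mul_sum, ← sum_inner, h0]
      simp
    rw [hz, ih]
    push_cast
    ring

theorem expect_norm_sub_mean_sq_le (X : α → H) {U : ℝ} (hX : ∀ a, ‖X a‖ ≤ U) :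
    𝔼 a, ‖X a - (Fintype.card α : ℝ)⁻¹ • ∑ i, X i‖ ^ 2 ≤ U ^ 2 := by
  set M := (Fintype.card α : ℝ)⁻¹ • ∑ i, X i with hM
  have hc : (Fintype.card α : ℝ) ≠ 0 := by exact_mod_cast Fintype.card_ne_zero
  have h1 : 𝔼 a, ⟪X a, M⟫_ℝ = ‖M‖ ^ 2 := by
    rw [Fintype.expect_eq_sum_div_card, ← sum_inner, div_eq_inv_mul, ← real_inner_smul_left, ← hM,
      real_inner_self_eq_norm_sq]
  simp_rw [norm_sub_sq_real, Finset.expect_add_distrib, Finset.expect_sub_distrib,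
    ← Finset.mul_expect, h1, Fintype.expect_const]
  have h2 : 𝔼 a, ‖X a‖ ^ 2 ≤ U ^ 2 := by
    rw [← Fintype.expect_const (ι := α) (U ^ 2)]
    exact Finset.expect_le_expect fun a _ => pow_le_pow_left₀ (norm_nonneg _) (hX a) 2
  nlinarith [sq_nonneg ‖M‖]

theorem sum_sub_mean (X : α → H) :
    ∑ a, (X a - (Fintype.card α : ℝ)⁻¹ • ∑ i, X i) = 0 := by
  have hc : (Fintype.card α : ℝ) ≠ 0 := by exact_mod_cast Fintype.card_ne_zero
  rw [Finset.sum_sub_distrib, Finset.sum_const, Finset.card_univ, ← Nat.cast_smul_eq_nsmul ℝ,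
    smul_smul, mul_inv_cancel₀ hc, one_smul, sub_self]

/-- Redrawing one entry changes the norm by at most `2 * U`, and the mean norm is at most `U * √b`
because the cross terms of the centred sum vanish on average. -/
theorem expect_exp_norm_sum_le (X : α → H) {U : ℝ} (hX : ∀ a, ‖X a‖ ≤ U) (b : ℕ) {θ : ℝ}
    (hθ : 0 ≤ θ) :
    𝔼 t : Fin b → α, Real.exp (θ * ‖∑ j, (X (t j) - (Fintype.card α : ℝ)⁻¹ • ∑ i, X i)‖)
      ≤ Real.exp (θ * (U * √b) + b * (θ ^ 2 * U ^ 2 / 2)) := by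
  classical
  have hU : 0 ≤ U := (norm_nonneg _).trans (hX (Classical.arbitrary α))
  set Y : α → H := fun a => X a - (Fintype.card α : ℝ)⁻¹ • ∑ i, X i with hY
  have hbd (t : Fin b → α) (j : Fin b) (a : α) :
      ‖∑ i, Y (t i)‖ - ‖∑ i, Y (Function.update t j a i)‖ ≤ 2 * U := by
    refine (norm_sub_norm_le _ _).trans ?_
    rw [← Finset.sum_sub_distrib, Finset.sum_eq_single j (fun i _ hi => by
      simp [Function.update_of_ne hi]) (by simp)]
    simp only [hY, Function.update_self, sub_sub_sub_cancel_right]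
    exact (norm_sub_le _ _).trans (by linarith [hX (t j), hX a])
  have hmean : 𝔼 t : Fin b → α, ‖∑ j, Y (t j)‖ ≤ U * √b := by
    have hsq : (𝔼 t : Fin b → α, ‖∑ j, Y (t j)‖) ^ 2 ≤ 𝔼 t : Fin b → α, ‖∑ j, Y (t j)‖ ^ 2 := by
      have := (convexOn_pow 2).map_expect_le (fun t : Fin b → α => ‖∑ j, Y (t j)‖)
        (fun t => norm_nonneg _)
      rwa [smul_eq_mul, ← div_eq_inv_mul, ← Fintype.expect_eq_sum_div_card] at this
    rw [expect_norm_sum_sq (sum_sub_mean X)] at hsq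
    refine le_of_sq_le_sq ?_ (by positivity)
    rw [mul_pow, Real.sq_sqrt (Nat.cast_nonneg _), mul_comm]
    exact hsq.trans (mul_le_mul_of_nonneg_left (expect_norm_sub_mean_sq_le X hX)
      (Nat.cast_nonneg _))
  refine (expect_exp_le_of_bounded_differences (fun t => ‖∑ j, Y (t j)‖) hbd θ).trans ?_
  refine Real.exp_le_exp.2 (add_le_add (mul_le_mul_of_nonneg_left hmean hθ) (le_of_eq ?_))
  ring

theorem convexOn_exp_mul_norm {θ : ℝ} (hθ : 0 ≤ θ) :
    ConvexOn ℝ Set.univ fun v : H => Real.exp (θ * ‖v‖) := by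
  refine ⟨convex_univ, fun v _ w _ a b ha hb hab => ?_⟩
  refine le_trans (Real.exp_le_exp.2 ?_)
    (convexOn_exp.2 (Set.mem_univ (θ * ‖v‖)) (Set.mem_univ (θ * ‖w‖)) ha hb hab)
  have := norm_add_le (a • v) (b • w)
  rw [norm_smul, norm_smul, Real.norm_of_nonneg ha, Real.norm_of_nonneg hb] at this
  refine (mul_le_mul_of_nonneg_left this hθ).trans_eq ?_
  simp only [smul_eq_mul]
  ring

end HilbertSums

theorem inv_smul_sum_sub_mean {V : Type*} [AddCommGroup V] [Module ℝ V] {b : ℕ} (hb : 0 < b)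
    (y : Fin b → V) (M : V) : (1 / (b : ℝ)) • ∑ j, y j - M = (1 / (b : ℝ)) • ∑ j, (y j - M) := by
  have : (b : ℝ) ≠ 0 := by exact_mod_cast hb.ne'
  rw [Finset.sum_sub_distrib, smul_sub, Finset.sum_const, Finset.card_univ, Fintype.card_fin,
    ← Nat.cast_smul_eq_nsmul ℝ, smul_smul, one_div_mul_cancel this, one_smul]

/-! ### Concentration of batch averages. -/

section BatchConcentration

variable {Ω : Type*} [MeasurableSpace Ω] {μ : Measure Ω} [IsProbabilityMeasure μ] {m b : ℕ}
  {S : Ω → Fin b → Fin m}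

/-- Concentration of the average of a uniform batch of vectors. -/
theorem IsUniformBatch.measureReal_norm_average_sub_mean_le {H : Type*} [NormedAddCommGroup H]
    [InnerProductSpace ℝ H] (hS : IsUniformBatch μ S) (hSm : Measurable S) (hm : 0 < m)
    (X : Fin m → H) {U : ℝ} (hU : 0 < U) (hX : ∀ i, ‖X i‖ ≤ U) {δ τ : ℝ} (hδ : 0 < δ ∧ δ < 1)
    (hτ : 0 < τ) (hb : U ^ 2 * (1 + √(8 * Real.log (1 / δ))) ^ 2 / τ ^ 2 ≤ b) :
    μ.real {ω | τ < ‖(1 / (b : ℝ)) • ∑ j, X (S ω j) - (1 / (m : ℝ)) • ∑ i, X i‖} ≤ δ ^ 4 := by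
  have : Nonempty (Fin m) := ⟨⟨0, hm⟩⟩
  set L := Real.log (1 / δ) with hL
  have hLpos : 0 < L := Real.log_pos (by rw [lt_div_iff₀ hδ.1]; linarith [hδ.2])
  set q := √(8 * L) with hq
  have hq0 : 0 ≤ q := Real.sqrt_nonneg _
  have hq2 : q ^ 2 = 8 * L := Real.sq_sqrt (by positivity)
  have hbpos : (0 : ℝ) < b := lt_of_lt_of_le (by positivity) hb
  set s := √(b : ℝ) with hs
  have hs0 : 0 < s := Real.sqrt_pos.2 hbpos
  have hs2 : s ^ 2 = b := Real.sq_sqrt hbpos.le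
  -- Minimizer of `b θ² U² / 2 - θ U s q`. The exponent becomes at most `q + 4 L - (q + q²) = -4 L`,
  -- whence `δ ^ 4`.
  set θ := q / (U * s) with hθ
  have hθ0 : 0 ≤ θ := by positivity
  have hτb : U * (1 + q) ≤ s * τ := by
    refine le_of_sq_le_sq ?_ (by positivity)
    rw [div_le_iff₀ (by positivity), ← hs2] at hb
    rw [mul_pow, mul_pow]
    exact hb
  have hmain := hS.mul_measureReal_le hSm (convexOn_exp_mul_norm (H := H) hθ0)
    (fun i => X i - (1 / (m : ℝ)) • ∑ i, X i) (fun _ => Set.mem_univ _)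
    (fun _ => (Real.exp_pos _).le)
    (T := {t | τ < ‖(1 / (b : ℝ)) • ∑ j, X (t j) - (1 / (m : ℝ)) • ∑ i, X i‖})
    (r := Real.exp (θ * (b * τ))) (fun t ht => by
      have ht : τ < ‖(1 / (b : ℝ)) • ∑ j, X (t j) - (1 / (m : ℝ)) • ∑ i, X i‖ := ht
      rw [inv_smul_sum_sub_mean (by exact_mod_cast hbpos), norm_smul,
        Real.norm_of_nonneg (by positivity), one_div, inv_mul_eq_div, lt_div_iff₀' hbpos] at ht
      exact Real.exp_le_exp.2 (mul_le_mul_of_nonneg_left ht.le hθ0))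
  have hexp := expect_exp_norm_sum_le X hX b hθ0
  rw [Fintype.card_fin, ← one_div] at hexp
  have h := hmain.trans hexp
  rw [← le_div_iff₀' (Real.exp_pos _), ← Real.exp_sub] at h
  refine h.trans ?_
  have hδ4 : δ ^ 4 = Real.exp (-(4 * L)) := by
    rw [hL, one_div, Real.log_inv, mul_neg, neg_neg, ← Real.log_rpow hδ.1,
      Real.exp_log (by have := hδ.1; positivity)]
    norm_cast
  rw [hδ4]
  refine Real.exp_le_exp.2 ?_
  have e1 : (b : ℝ) * (θ ^ 2 * U ^ 2 / 2) = 4 * L := by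
    rw [← hs2, hθ, div_pow, hq2]
    field_simp
    norm_num
  have e2 : θ * (U * s) = q := by rw [hθ]; field_simp
  have e3 : θ * (U * s) + θ * (U * s) * q ≤ θ * (b * τ) := by
    have := mul_le_mul_of_nonneg_left hτb (by positivity : 0 ≤ θ * s)
    rw [← hs2]
    linarith
  rw [e1, e2] at *
  nlinarith

/-- Concentration of the average of a uniform batch of symmetric operators. -/
theorem IsUniformBatch.measureReal_norm_average_operator_sub_mean_le {E : Type*}
    [NormedAddCommGroup E] [InnerProductSpace ℝ E] [FiniteDimensional ℝ E]
    (hS : IsUniformBatch μ S) (hSm : Measurable S) (hm : 0 < m)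
    (X : Fin m → E →L[ℝ] E) (hsym : ∀ i, (X i : E →ₗ[ℝ] E).IsSymmetric) {U : ℝ} (hU : 0 < U)
    (hX : ∀ i, ‖X i‖ ≤ U) {τ : ℝ} (hτ : 0 < τ) (hb : 0 < b) :
    μ.real {ω | τ < ‖(1 / (b : ℝ)) • ∑ j, X (S ω j) - (1 / (m : ℝ)) • ∑ i, X i‖}
      ≤ 2 * Module.finrank ℝ E * Real.exp (-(b * τ ^ 2 / (4 * U ^ 2))) := by
  have : Nonempty (Fin m) := ⟨⟨0, hm⟩⟩
  have hbpos : (0 : ℝ) < b := by exact_mod_cast hb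
  set M : E →L[ℝ] E := (1 / (m : ℝ)) • ∑ i, X i with hM
  have hsum (κ : Type) (s : Finset κ) (Z : κ → E →ₗ[ℝ] E) (hZ : ∀ i, (Z i).IsSymmetric) :
      (∑ i ∈ s, Z i).IsSymmetric :=
    Finset.sum_induction _ LinearMap.IsSymmetric (fun _ _ => LinearMap.IsSymmetric.add)
      LinearMap.IsSymmetric.zero fun i _ => hZ i
  have hMsym : (M : E →ₗ[ℝ] E).IsSymmetric := by
    have : (M : E →ₗ[ℝ] E) = (1 / (m : ℝ)) • ∑ i, (X i : E →ₗ[ℝ] E) := by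
      ext v; simp [hM]
    rw [this]
    exact LinearMap.IsSymmetric.smul (by simp) (hsum _ _ _ hsym)
  set Y : Fin m → E →ₗ[ℝ] E := fun i => ((X i - M : E →L[ℝ] E) : E →ₗ[ℝ] E) with hY
  have hYsym (i : Fin m) : (Y i).IsSymmetric := (hsym i).sub hMsym
  have hY0 : ∑ i, Y i = 0 := by
    have hm' : (m : ℝ) ≠ 0 := by exact_mod_cast hm.ne'
    ext v
    simp [hY, hM, hm', Finset.sum_sub_distrib, ← Nat.cast_smul_eq_nsmul ℝ, smul_smul]
  have hYc (i j : Fin m) (v : E) : ‖(Y i - Y j) v‖ ≤ 2 * U * ‖v‖ := by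
    have e : (Y i - Y j) v = (X i - X j) v := by simp [hY]
    rw [e]
    refine (ContinuousLinearMap.le_opNorm _ _).trans
      (mul_le_mul_of_nonneg_right ?_ (norm_nonneg _))
    exact (norm_sub_le _ _).trans (by linarith [hX i, hX j])
  have htail := le_exp_of_forall_pow_mul_le (r := b * τ) (d := Module.finrank ℝ E)
    (σ := b * ((2 * U) ^ 2 / 2)) (P := μ.real
      {ω | τ < ‖(1 / (b : ℝ)) • ∑ j, X (S ω j) - M‖}) measureReal_nonneg (by positivity)
    (fun p => by
      have hmom := expect_trace_pow_le (ι := Fin b) hYsym hY0 hYc p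
      rw [Fintype.card_fin] at hmom
      refine le_trans ?_ hmom
      have htr (t : Fin b → Fin m) : (∑ j, Y (t j)).IsSymmetric := hsum _ _ _ fun j => hYsym _
      refine hS.mul_measureReal_le hSm (convexOn_trace_pow (E := E) p) Y (fun t => htr t)
        (fun t => trace_even_pow_nonneg (htr t) p) (T := {t | τ < ‖(1 / (b : ℝ)) • ∑ j, X (t j) - M‖}) (fun t ht => ?_)
      · have ht : τ < ‖(1 / (b : ℝ)) • ∑ j, X (t j) - M‖ := ht
        rw [inv_smul_sum_sub_mean hb, norm_smul,
          Real.norm_of_nonneg (by positivity), one_div, inv_mul_eq_div, lt_div_iff₀' hbpos] at ht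
        obtain ⟨v, hv⟩ : ∃ v, b * τ * ‖v‖ < ‖(∑ j, Y (t j)) v‖ := by
          by_contra! hcon
          refine absurd ht (not_lt.2 (ContinuousLinearMap.opNorm_le_bound _ (by positivity)
            fun v => ?_))
          have e : (∑ j, (X (t j) - M)) v = (∑ j, Y (t j)) v := by simp [hY]
          rw [e]
          exact hcon v
        exact norm_pow_le_trace (htr t) (by positivity) hv p)
  refine htail.trans_eq ?_
  congr 3
  field_simp
  norm_num

end BatchConcentration

/-! ### Gradients, Hessians and the descent lemma. -/

section Calculus

variable {n m : ℕ}

theorem hasFDerivAt_innerSL_gradient {f : EucSp n → ℝ} {x : EucSp n}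
    (hf : DifferentiableAt ℝ f x) : HasFDerivAt f (innerSL ℝ (gradient f x)) x :=
  hf.hasGradientAt.hasFDerivAt

theorem hasGradientAt_finiteSum {f : Fin m → EucSp n → ℝ} (hf : ∀ i, Differentiable ℝ (f i))
    (x : EucSp n) :
    HasGradientAt (finiteSum f) ((1 / (m : ℝ)) • ∑ i, gradient (f i) x) x := by
  have h : HasFDerivAt (finiteSum f)
      ((1 / (m : ℝ)) • ∑ i, innerSL ℝ (gradient (f i) x)) x := by
    have := (HasFDerivAt.fun_sum (u := Finset.univ)
      fun i _ => hasFDerivAt_innerSL_gradient (hf i x)).const_mul (1 / (m : ℝ))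
    exact this
  rw [← map_sum, ← map_smul] at h
  exact h

theorem gradient_finiteSum {f : Fin m → EucSp n → ℝ} (hf : ∀ i, Differentiable ℝ (f i))
    (x : EucSp n) : gradient (finiteSum f) x = (1 / (m : ℝ)) • ∑ i, gradient (f i) x :=
  (hasGradientAt_finiteSum hf x).gradient

theorem hessian_finiteSum {f : Fin m → EucSp n → ℝ} (hf₁ : ∀ i, Differentiable ℝ (f i))
    (hf₂ : ∀ i, Differentiable ℝ (gradient (f i))) (x : EucSp n) :
    hessian (finiteSum f) x = (1 / (m : ℝ)) • ∑ i, hessian (f i) x := by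
  have h : HasFDerivAt (fun y => (1 / (m : ℝ)) • ∑ i, gradient (f i) y)
      ((1 / (m : ℝ)) • ∑ i, hessian (f i) x) x :=
    (HasFDerivAt.fun_sum fun i _ => (hf₂ i x).hasFDerivAt).fun_const_smul _
  have e : gradient (finiteSum f) = fun y => (1 / (m : ℝ)) • ∑ i, gradient (f i) y :=
    funext (gradient_finiteSum hf₁)
  rw [hessian, e]
  exact h.fderiv

/-- Symmetry of second derivatives needs no continuity of the Hessian, which the components are not
assumed to have. -/
theorem hessian_isSymmetric {f : EucSp n → ℝ} (hf : Differentiable ℝ f) {x : EucSp n}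
    (hg : DifferentiableAt ℝ (gradient f) x) :
    (hessian f x : EucSp n →ₗ[ℝ] EucSp n).IsSymmetric := by
  intro v w
  have h2 : HasFDerivAt (fun y => innerSL ℝ (gradient f y))
      ((innerSL ℝ : EucSp n →L[ℝ] EucSp n →L[ℝ] ℝ).comp (hessian f x)) x :=
    (innerSL ℝ : EucSp n →L[ℝ] EucSp n →L[ℝ] ℝ).hasFDerivAt.comp x hg.hasFDerivAt
  have := second_derivative_symmetric (fun y => hasFDerivAt_innerSL_gradient (hf y)) h2 v w
  simpa [real_inner_comm] using this

theorem SmoothObjective.differentiable {f : EucSp n → ℝ} {L : ℝ} (h : SmoothObjective f L) :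
    Differentiable ℝ f := h.contDiff.differentiable (by norm_num)

theorem SmoothObjective.norm_hessian_le {f : EucSp n → ℝ} {L : ℝ} (hL : 0 ≤ L)
    (h : SmoothObjective f L) (x : EucSp n) : ‖hessian f x‖ ≤ L := by
  have hlip : LipschitzWith L.toNNReal (gradient f) := LipschitzWith.of_dist_le_mul fun a b => by
    rw [dist_eq_norm, dist_eq_norm, Real.coe_toNNReal _ hL]
    exact h.lipschitz a b
  simpa [hessian, Real.coe_toNNReal _ hL] using norm_fderiv_le_of_lipschitz ℝ hlip (x₀ := x)

theorem SmoothObjective.le_add_inner_add_sq {f : EucSp n → ℝ} {L : ℝ} (h : SmoothObjective f L)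
    (x d : EucSp n) : f (x + d) ≤ f x + ⟪gradient f x, d⟫_ℝ + L / 2 * ‖d‖ ^ 2 := by
  set G : ℝ → ℝ := fun t => f (x + t • d) - t * ⟪gradient f x, d⟫_ℝ - t ^ 2 * (L / 2 * ‖d‖ ^ 2)
  have hG (t : ℝ) : HasDerivAt G (⟪gradient f (x + t • d), d⟫_ℝ - ⟪gradient f x, d⟫_ℝ
      - 2 * t * (L / 2 * ‖d‖ ^ 2)) t := by
    have hl : HasDerivAt (fun t : ℝ => x + t • d) d t := by
      simpa using ((hasDerivAt_id t).smul_const d).const_add x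
    have h1 := (hasFDerivAt_innerSL_gradient (h.differentiable (x + t • d))).comp_hasDerivAt t hl
    have h2 := (h1.sub ((hasDerivAt_id t).mul_const ⟪gradient f x, d⟫_ℝ)).sub
      ((hasDerivAt_pow 2 t).mul_const (L / 2 * ‖d‖ ^ 2))
    simp only [innerSL_apply_apply, one_mul, Nat.cast_ofNat, Nat.add_one_sub_one, pow_one] at h2
    exact h2
  have hanti : AntitoneOn G (Set.Icc 0 1) := by
    refine antitoneOn_of_deriv_nonpos (convex_Icc 0 1)
      (fun t _ => (hG t).continuousAt.continuousWithinAt)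
      (fun t _ => (hG t).differentiableAt.differentiableWithinAt) fun t ht => ?_
    rw [interior_Icc] at ht
    rw [(hG t).deriv, ← inner_sub_left]
    have h1 := (real_inner_le_norm (gradient f (x + t • d) - gradient f x) d).trans
      (mul_le_mul_of_nonneg_right (h.lipschitz (x + t • d) x) (norm_nonneg d))
    rw [add_sub_cancel_left, norm_smul, Real.norm_of_nonneg ht.1.le] at h1
    linarith
  have := hanti (Set.left_mem_Icc.2 zero_le_one) (Set.right_mem_Icc.2 zero_le_one) zero_le_one
  simp only [G, one_smul, zero_smul, add_zero, one_mul, one_pow, zero_mul, sub_zero, ne_eq,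
    OfNat.ofNat_ne_zero, not_false_eq_true, zero_pow] at this
  linarith

end Calculus

/-! ### The minimal eigenvalue as a lower bound of the quadratic form. -/

section MinimalEigenvalue

variable {n : ℕ} {Q : EucSp n →L[ℝ] EucSp n}

theorem abs_le_norm_of_hasEigenvalue {a : ℝ}
    (ha : Module.End.HasEigenvalue (Q : EucSp n →ₗ[ℝ] EucSp n) a) : |a| ≤ ‖Q‖ := by
  obtain ⟨v, hv⟩ := ha.exists_hasEigenvector
  have h1 : Q v = a • v := hv.apply_eq_smul
  have h2 := Q.le_opNorm v
  rw [h1, norm_smul, Real.norm_eq_abs] at h2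
  exact le_of_mul_le_mul_right h2 (norm_pos_iff.2 hv.2)

theorem lambdaMin_mul_le_inner (hQ : (Q : EucSp n →ₗ[ℝ] EucSp n).IsSymmetric) (v : EucSp n) :
    lambdaMin Q * ‖v‖ ^ 2 ≤ ⟪Q v, v⟫_ℝ := by
  have hle (i) : lambdaMin Q ≤ hQ.eigenvalues rfl i := by
    refine csInf_le ⟨-‖Q‖, fun a ha => ?_⟩ (hQ.hasEigenvalue_eigenvalues rfl i)
    exact (abs_le.1 (abs_le_norm_of_hasEigenvalue ha)).1
  rw [← (hQ.eigenvectorBasis rfl).sum_sq_norm_inner_right v,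
    ← (hQ.eigenvectorBasis rfl).sum_inner_mul_inner, Finset.mul_sum]
  refine Finset.sum_le_sum fun i _ => ?_
  have h1 : ⟪Q v, hQ.eigenvectorBasis rfl i⟫_ℝ
      = hQ.eigenvalues rfl i * ⟪hQ.eigenvectorBasis rfl i, v⟫_ℝ := by
    have h2 := hQ v (hQ.eigenvectorBasis rfl i)
    rw [hQ.apply_eigenvectorBasis, real_inner_smul_right, real_inner_comm] at h2
    rw [real_inner_comm]
    simpa [real_inner_comm] using h2
  rw [h1, Real.norm_eq_abs, sq_abs, mul_assoc, ← sq]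
  exact mul_le_mul_of_nonneg_right (hle i) (sq_nonneg _)

theorem neg_lambdaMin_le_norm : -lambdaMin Q ≤ ‖Q‖ := by
  rw [neg_le]
  -- In dimension zero there are no eigenvalues and `sInf ∅ = 0`; the second argument covers this
  -- case.
  exact Real.le_sInf (fun a ha => (abs_le.1 (abs_le_norm_of_hasEigenvalue ha)).1)
    (by simp)

end MinimalEigenvalue

/-! ### Deterministic decrease and the iteration bound. -/

theorem regParam_mul_eq {γ L η δg δh : ℝ} (hδg : δg < 1 / 2) :
    regParam γ L η δg δh * (1 - 2 * δg) = γ * (L + η + 2 * δg * (η / 2 + 2 * L + 2 * δh)) := by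
  have : 1 - 2 * δg ≠ 0 := by linarith
  rw [regParam]
  field_simp

theorem regParam_add_le_betaTilde {γ L η δg δh δgBar δhBar : ℝ} (hγ : 1 < γ) (hL : 0 < L)
    (hη : 0 ≤ η ∧ η < 1) (hδgBar : δgBar < 1 / 2) (hδg : 0 < δg ∧ δg ≤ δgBar)
    (hδh : 0 < δh ∧ δh ≤ δhBar) :
    2 * L + 2 * δh + regParam γ L η δg δh ≤ betaTilde L γ δgBar δhBar := by
  rw [regParam, betaTilde, ← mul_div_assoc]
  obtain ⟨h1, h2⟩ := hη
  obtain ⟨h3, h4⟩ := hδg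
  obtain ⟨h5, h6⟩ := hδh
  have : 0 < 1 - 2 * δgBar := by linarith
  have hγ0 : 0 < γ := by linarith
  have hB : 0 < δgBar := by linarith
  have hh : 0 < δhBar := by linarith
  gcongr

/-- Sufficient decrease of one step of the regularized Newton method with accurate
approximations. -/
theorem lt_sub_of_regNewton_step {n : ℕ} {F : EucSp n → ℝ} {L : ℝ} (hL : 0 < L)
    (hF : SmoothObjective F L) {γ η δg δh δgBar δhBar ε : ℝ} (hγ : 1 < γ)
    (hη : 0 ≤ η ∧ η < 1) (hδgBar : δgBar < 1 / 2) (hδg : 0 < δg ∧ δg ≤ δgBar)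
    (hδh : 0 < δh ∧ δh ≤ δhBar) (hε : 0 < ε) {x d g : EucSp n} {Q : EucSp n →L[ℝ] EucSp n}
    (hQ : (Q : EucSp n →ₗ[ℝ] EucSp n).IsSymmetric)
    (hgacc : ‖g - gradient F x‖ ≤ δg * ε) (hQacc : ‖Q - hessian F x‖ ≤ δh) (hg : ε < ‖g‖)
    (hd : ‖regHessian Q (regParam γ L η δg δh) d + g‖ ≤ η / 2 * ‖d‖) :
    F (x + d) < F x
      - (γ - 1) * L * ε ^ 2 / (2 * (3 / 2 + betaTilde L γ δgBar δhBar ^ 2)) := by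
  set c := regParam γ L η δg δh with hc
  set D := ‖d‖ with hD
  have hD0 : 0 ≤ D := norm_nonneg d
  have hc1 : c * (1 - 2 * δg) = γ * (L + η + 2 * δg * (η / 2 + 2 * L + 2 * δh)) :=
    regParam_mul_eq (by linarith [hδg.2])
  set A := L + η + 2 * δg * (η / 2 + 2 * L + 2 * δh) with hA
  have hAL : L ≤ A := by
    have : 0 ≤ 2 * δg * (η / 2 + 2 * L + 2 * δh) := by
      have := hδg.1; have := hδh.1; have := hη.1; positivity
    linarith [hη.1]
  have hγA : 0 < γ * A := by have : 0 < A := by linarith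
                             positivity
  have hc0 : 0 < c := by
    have h12 : 0 < 1 - 2 * δg := by linarith [hδg.2]
    by_contra! hcon
    have := mul_nonpos_of_nonpos_of_nonneg hcon h12.le
    linarith
  have hcA : γ * A ≤ c := by
    have := mul_pos hc0 hδg.1
    linarith
  have hQn : ‖Q‖ ≤ L + δh := by
    have := norm_add_le (Q - hessian F x) (hessian F x)
    rw [sub_add_cancel] at this
    linarith [hF.norm_hessian_le hL.le x]
  set s := max (-lambdaMin Q) 0 with hs
  have hs0 : 0 ≤ s := le_max_right _ _
  have hsn : s ≤ L + δh := max_le (neg_lambdaMin_le_norm.trans hQn) (by linarith [hδh.1])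
  have hHd : regHessian Q c d = Q d + (s + c) • d := by simp [regHessian, hs]
  have hHnorm : ‖regHessian Q c d‖ ≤ (2 * L + 2 * δh + c) * D := by
    rw [hHd]
    refine (norm_add_le _ _).trans ?_
    rw [norm_smul, Real.norm_of_nonneg (by linarith)]
    have h1 := (Q.le_opNorm d).trans (mul_le_mul_of_nonneg_right hQn hD0)
    have h2 := mul_le_mul_of_nonneg_right hsn hD0
    rw [← hD]
    linarith
  have hHinner : c * D ^ 2 ≤ ⟪regHessian Q c d, d⟫_ℝ := by
    rw [hHd, inner_add_left, real_inner_smul_left, real_inner_self_eq_norm_sq, ← hD]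
    have h1 := lambdaMin_mul_le_inner hQ d
    have h2 : 0 ≤ (lambdaMin Q + s) * D ^ 2 :=
      mul_nonneg (by linarith [le_max_left (-lambdaMin Q) 0]) (sq_nonneg _)
    linarith
  have hgn : ‖g‖ ≤ (2 * L + 2 * δh + c + η / 2) * D := by
    have := norm_sub_le (regHessian Q c d + g) (regHessian Q c d)
    rw [add_sub_cancel_left] at this
    linarith
  have hinner : ⟪gradient F x, d⟫_ℝ ≤ η / 2 * D ^ 2 - c * D ^ 2
      + δg * ((2 * L + 2 * δh + c + η / 2) * D ^ 2) := by
    have e : ⟪gradient F x, d⟫_ℝ = ⟪regHessian Q c d + g, d⟫_ℝ - ⟪regHessian Q c d, d⟫_ℝ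
        - ⟪g - gradient F x, d⟫_ℝ := by
      rw [inner_add_left, inner_sub_left]; ring
    have h1 := (real_inner_le_norm (regHessian Q c d + g) d).trans
      (mul_le_mul_of_nonneg_right hd hD0)
    have h2 := (abs_le.1 (abs_real_inner_le_norm (g - gradient F x) d)).1
    have h3 := mul_le_mul_of_nonneg_right hgacc hD0
    -- Here `ε < ‖g‖` turns the absolute gradient error into one proportional to `‖d‖`.
    have h4 := mul_le_mul_of_nonneg_right
      (mul_le_mul_of_nonneg_left (hg.le.trans hgn) hδg.1.le) hD0
    rw [e]
    rw [← hD] at h2 h1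
    linarith
  have hdesc := hF.le_add_inner_add_sq x d
  -- This determines the form of `c`: by `c * (1 - 2 * δg) = γ * A` and `γ * A ≤ c`, the left side
  -- is at most `A / 2 - γ * A`.
  have hcoef : η / 2 + L / 2 - c + δg * (2 * L + 2 * δh + c + η / 2) ≤ -((γ - 1) * L) := by
    have h1 := mul_le_mul_of_nonneg_left hAL (by linarith : 0 ≤ γ - 1)
    have h2 : η / 2 + L / 2 - c + δg * (2 * L + 2 * δh + c + η / 2)
        = A / 2 - c / 2 - c * (1 - 2 * δg) / 2 := by rw [hA]; ring
    rw [h2, hc1]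
    linarith
  have hdec : F (x + d) ≤ F x - (γ - 1) * L * D ^ 2 := by
    have := mul_le_mul_of_nonneg_right hcoef (sq_nonneg D)
    rw [← hD] at hdesc
    linarith
  have hβ := regParam_add_le_betaTilde hγ hL hη hδgBar hδg hδh
  rw [← hc] at hβ
  set B := betaTilde L γ δgBar δhBar with hB
  have hB0 : 0 ≤ B := by linarith [hδh.1]
  have hεD : ε ^ 2 < 2 * (3 / 2 + B ^ 2) * D ^ 2 := by
    have h1 : ε < (B + 1 / 2) * D := lt_of_lt_of_le (hg.trans_le hgn)
      (mul_le_mul_of_nonneg_right (by linarith [hη.2]) hD0)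
    have h2 := pow_lt_pow_left₀ h1 hε.le two_ne_zero
    rw [mul_pow] at h2
    refine h2.trans_le (mul_le_mul_of_nonneg_right ?_ (sq_nonneg D))
    nlinarith [sq_nonneg (B - 1 / 2)]
  refine hdec.trans_lt ?_
  have hlt : (γ - 1) * L * ε ^ 2 / (2 * (3 / 2 + B ^ 2)) < (γ - 1) * L * D ^ 2 := by
    rw [div_lt_iff₀ (by positivity), mul_assoc ((γ - 1) * L)]
    refine mul_lt_mul_of_pos_left (by linarith) (mul_pos (by linarith) hL)
  linarith

/-- If the approximations are accurate at every iterate of the initial level set, the stopping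
test succeeds before the iteration bound is exceeded. -/
theorem exists_stopping_iteration {n : ℕ} {F : EucSp n → ℝ} {L : ℝ} (hL : 0 < L)
    (hF : SmoothObjective F L) {fstar : ℝ} (hfstar : fstar ∈ lowerBounds (Set.range F))
    {x₀ : EucSp n} {γ : ℝ} (hγ : 1 < γ) {η δg δh : ℕ → ℝ} {δgBar δhBar ε : ℝ}
    (hη : ∀ k, 0 ≤ η k ∧ η k < 1) (hδgBar : δgBar < 1 / 2)
    (hδg : ∀ k, 0 < δg k ∧ δg k ≤ δgBar) (hδh : ∀ k, 0 < δh k ∧ δh k ≤ δhBar) (hε : 0 < ε)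
    {g x : ℕ → EucSp n} {Q : ℕ → EucSp n →L[ℝ] EucSp n}
    (hrun : IsRegNewtonRun L γ η δg δh x₀ g Q x)
    (hQ : ∀ k, (Q k : EucSp n →ₗ[ℝ] EucSp n).IsSymmetric) (hgap : fstar < F x₀)
    (hacc : ∀ k < iterBound L γ δgBar δhBar (F x₀ - fstar) ε, F (x k) ≤ F x₀ →
      ‖g k - gradient F (x k)‖ ≤ δg k * ε ∧ ‖Q k - hessian F (x k)‖ ≤ δh k) :
    ∃ k ≤ iterBound L γ δgBar δhBar (F x₀ - fstar) ε, (∀ j < k, ε < ‖g j‖) ∧ ‖g k‖ ≤ ε ∧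
      ‖gradient F (x k)‖ ≤ 2 * ε := by
  set K := iterBound L γ δgBar δhBar (F x₀ - fstar) ε with hK
  set B := betaTilde L γ δgBar δhBar
  set w := (γ - 1) * L * ε ^ 2 / (2 * (3 / 2 + B ^ 2)) with hw
  have hγL : 0 < (γ - 1) * L := mul_pos (by linarith) hL
  have hw0 : 0 < w := by positivity
  -- The decrease keeps the iterates in the initial level set, where accuracy is available.
  -- Strictness for `0 < k` gives a stopping index below `K`, so accuracy before `K` also covers the
  -- stopping iterate.
  have hdecr (k : ℕ) (hk : k ≤ K) (hlarge : ∀ j < k, ε < ‖g j‖) :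
      F (x k) ≤ F x₀ - k * w ∧ (0 < k → F (x k) < F x₀ - k * w) := by
    induction k with
    | zero => simp [hrun.init]
    | succ k ih =>
      have h1 := (ih (by omega) fun j hj => hlarge j (by omega)).1
      have hlev : F (x k) ≤ F x₀ := by
        have : 0 ≤ k * w := by positivity
        linarith
      obtain ⟨d, hd, hx⟩ := hrun.step k
      obtain ⟨hg1, hQ1⟩ := hacc k (by omega) hlev
      have h2 := lt_sub_of_regNewton_step hL hF hγ (hη k) hδgBar (hδg k) (hδh k) hε (hQ k) hg1 hQ1
        (hlarge k (by omega)) hd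
      rw [← hx] at h2
      have h3 : F (x (k + 1)) < F x₀ - (k + 1 : ℕ) * w := by push_cast; linarith
      exact ⟨h3.le, fun _ => h3⟩
  have hKw : F x₀ - fstar ≤ K * w := by
    have h1 : 2 * (3 / 2 + B ^ 2) * (F x₀ - fstar) / ((γ - 1) * L * ε ^ 2) ≤ K := Nat.le_ceil _
    rw [div_le_iff₀ (by positivity)] at h1
    rw [hw, mul_div_assoc', le_div_iff₀ (by positivity)]
    linarith
  have hKpos : 0 < K := by
    rcases Nat.eq_zero_or_pos K with h0 | h0
    · rw [h0] at hKw
      simp only [Nat.cast_zero, zero_mul] at hKw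
      linarith
    · exact h0
  have hex : ∃ k, k < K ∧ ‖g k‖ ≤ ε := by
    by_contra! hcon
    have := (hdecr K le_rfl hcon).2 hKpos
    have h2 := hfstar ⟨x K, rfl⟩
    linarith
  classical
  obtain ⟨hkK, hkg⟩ := Nat.find_spec hex
  set k := Nat.find hex
  have hlarge : ∀ j < k, ε < ‖g j‖ := fun j hj => by
    have := Nat.find_min hex hj
    by_contra! hcon
    exact this ⟨by omega, hcon⟩
  refine ⟨k, hkK.le, hlarge, hkg, ?_⟩
  have hlev : F (x k) ≤ F x₀ := by
    have h1 := (hdecr k hkK.le hlarge).1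
    have : 0 ≤ k * w := by positivity
    linarith
  have h1 := (hacc k hkK hlev).1
  have h2 := norm_sub_le (g k) (g k - gradient F (x k))
  rw [sub_sub_cancel] at h2
  have h3 : δg k * ε ≤ 1 * ε := mul_le_mul_of_nonneg_right (by linarith [(hδg k).2]) hε.le
  linarith

/-! ### Fresh randomness against the past. -/

/-- If a fresh random element `S` is good with probability at least `c` whatever the value of the
past, then a past event `D` loses at most the factor `c` when goodness is required as well. -/
theorem mul_measureReal_le_of_indep {Ω A X : Type*} {m' mΩ : MeasurableSpace Ω} (hm : m' ≤ mΩ)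
    {μ : Measure Ω} [IsProbabilityMeasure μ] [MeasurableSpace A] [MeasurableSpace X]
    {S : Ω → A} (hS : Measurable S) (hind : Indep (MeasurableSpace.comap S inferInstance) m' μ)
    {x : Ω → X} (hx : Measurable[m'] x) {D : Set Ω} (hD : MeasurableSet[m'] D) {G : Set (A × X)}
    (hG : MeasurableSet G) {c : ℝ} (hc : 0 ≤ c) (hgood : ∀ y, c ≤ μ.real {ω | (S ω, y) ∈ G}) :
    c * μ.real D ≤ μ.real (D ∩ {ω | (S ω, x ω) ∈ G}) := by
  -- The past event is carried as a `Prop`-valued coordinate, so that independence of `S` and `z`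
  -- gives one product law; Fubini then integrates over `S` first.
  set z : Ω → X × Prop := fun ω => (x ω, ω ∈ D) with hz
  have hz' : Measurable[m'] z := hx.prodMk (@measurableSet_setOfPred _ m' _ |>.1 hD)
  have hzm : Measurable z := hz'.mono hm le_rfl
  have hindep : IndepFun S z μ :=
    indep_of_indep_of_le_right hind (hz'.comap_le)
  have hmap := (indepFun_iff_map_prod_eq_prod_map_map hS.aemeasurable hzm.aemeasurable).1 hindep
  set G' : Set (A × (X × Prop)) := {p | p.2.2 ∧ (p.1, p.2.1) ∈ G} with hG'
  have hG'm : MeasurableSet G' := by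
    refine MeasurableSet.inter (measurableSet_setOfPred.2 (measurable_snd.comp measurable_snd)) ?_
    exact (measurable_fst.prodMk (measurable_fst.comp measurable_snd)) hG
  have e1 : D ∩ {ω | (S ω, x ω) ∈ G} = (fun ω => (S ω, z ω)) ⁻¹' G' := by
    ext ω; simp [hz, hG']
  have hDm : MeasurableSet D := hm _ hD
  have : IsProbabilityMeasure (μ.map S) := Measure.isProbabilityMeasure_map hS.aemeasurable
  have : IsProbabilityMeasure (μ.map z) := Measure.isProbabilityMeasure_map hzm.aemeasurable
  have key : ENNReal.ofReal c * μ D ≤ μ (D ∩ {ω | (S ω, x ω) ∈ G}) := by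
    rw [e1, ← Measure.map_apply (hS.prodMk hzm) hG'm, hmap, Measure.prod_apply_symm hG'm,
      lintegral_map (measurable_measure_prodMk_right hG'm) hzm, ← lintegral_indicator_const hDm]
    refine lintegral_mono fun ω => ?_
    by_cases hω : ω ∈ D
    · rw [Set.indicator_of_mem hω, Measure.map_apply hS (measurable_prodMk_right hG'm)]
      refine (ENNReal.ofReal_le_ofReal (hgood (x ω))).trans ?_
      rw [measureReal_def, ENNReal.ofReal_toReal (measure_ne_top _ _)]
      exact measure_mono fun ω' h => ⟨hω, h⟩
    · rw [Set.indicator_of_notMem hω]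
      exact zero_le
  have := ENNReal.toReal_mono (measure_ne_top _ _) key
  rwa [ENNReal.toReal_mul, ENNReal.toReal_ofReal hc] at this

/-! ### Probability that both batches are accurate at a fixed point. -/

/-- The slack is `δ (1 - δ)² / 2` after `δ ^ 4 ≤ δ ^ 2`. A union bound would not do: `δ ^ 4 + δ / 2`
exceeds `δ` for `δ` near `1`, so independence of the two batches matters. -/
theorem one_sub_le_mul_one_sub {δ p q : ℝ} (hδ : 0 < δ ∧ δ < 1) (hp : p ≤ δ ^ 4)
    (hq : q ≤ δ / 2) : 1 - δ ≤ (1 - p) * (1 - q) := by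
  obtain ⟨h0, h1⟩ := hδ
  have h2 : δ ^ 4 ≤ δ ^ 2 := pow_le_pow_of_le_one h0.le h1.le (by norm_num)
  have h3 : (1 - δ ^ 2) * (1 - δ / 2) ≤ (1 - p) * (1 - q) :=
    mul_le_mul (by linarith) (by linarith) (by linarith) (by nlinarith)
  nlinarith [mul_pos h0 (sub_pos.2 h1), mul_nonneg (mul_pos h0 (sub_pos.2 h1)).le (sub_pos.2 h1).le]

theorem two_mul_exp_le {n : ℕ} (hn : 0 < n) {δ U τ b : ℝ} (hδ : 0 < δ ∧ δ < 1) (hU : 0 < U)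
    (hτ : 0 < τ) (hb : 16 * U ^ 2 / τ ^ 2 * Real.log (2 * (n : ℝ) / δ) ≤ b) :
    2 * (n : ℝ) * Real.exp (-(b * τ ^ 2 / (4 * U ^ 2))) ≤ δ / 2 := by
  have hn1 : (1 : ℝ) ≤ n := by exact_mod_cast hn
  set y := 2 * (n : ℝ) / δ with hy
  have hy2 : 2 ≤ y := by rw [hy, le_div_iff₀ hδ.1]; linarith [hδ.2]
  have hlog : 0 ≤ Real.log y := Real.log_nonneg (by linarith)
  have h1 : 2 * Real.log y ≤ b * τ ^ 2 / (4 * U ^ 2) := by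
    rw [le_div_iff₀ (by positivity)]
    rw [div_mul_eq_mul_div, div_le_iff₀ (by positivity)] at hb
    nlinarith [mul_nonneg hlog (sq_nonneg U)]
  have h2 : Real.exp (-(b * τ ^ 2 / (4 * U ^ 2))) ≤ (y ^ 2)⁻¹ := by
    refine (Real.exp_le_exp.2 (neg_le_neg h1)).trans_eq ?_
    rw [Real.exp_neg, two_mul, Real.exp_add, Real.exp_log (by linarith), sq]
  have e : 2 * (n : ℝ) = δ * y := by rw [hy]; have := hδ.1; field_simp
  refine (mul_le_mul_of_nonneg_left h2 (by positivity)).trans ?_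
  rw [e, ← div_eq_mul_inv, div_le_iff₀ (by positivity)]
  nlinarith [mul_nonneg (mul_nonneg hδ.1.le (by linarith : 0 ≤ y)) (by linarith : 0 ≤ y - 2)]

section Sampling

variable {n m : ℕ} {f : Fin m → EucSp n → ℝ}

theorem subHessian_isSymmetric (hf₁ : ∀ i, Differentiable ℝ (f i))
    (hf₂ : ∀ i, Differentiable ℝ (gradient (f i))) {b : ℕ} (s : Fin b → Fin m) (y : EucSp n) :
    (subHessian f s y : EucSp n →ₗ[ℝ] EucSp n).IsSymmetric := by
  have e : (subHessian f s y : EucSp n →ₗ[ℝ] EucSp n)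
      = (1 / (b : ℝ)) • ∑ j, (hessian (f (s j)) y : EucSp n →ₗ[ℝ] EucSp n) := by
    ext v; simp [subHessian]
  rw [e]
  exact LinearMap.IsSymmetric.smul (by simp)
    (Finset.sum_induction _ LinearMap.IsSymmetric (fun _ _ => LinearMap.IsSymmetric.add)
      LinearMap.IsSymmetric.zero fun j _ => hessian_isSymmetric (hf₁ _) (hf₂ _ y))

/-- The batches and the iterate for which the approximations meet the required accuracies, unless
the iterate lies outside the level set `{F ≤ a}`. -/
def accurateSet (f : Fin m → EucSp n → ℝ) (a τg τh : ℝ) (bg bh : ℕ) :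
    Set (((Fin bg → Fin m) × (Fin bh → Fin m)) × EucSp n) :=
  {p | finiteSum f p.2 ≤ a →
    ‖subGradient f p.1.1 p.2 - gradient (finiteSum f) p.2‖ ≤ τg ∧
      ‖subHessian f p.1.2 p.2 - hessian (finiteSum f) p.2‖ ≤ τh}

theorem measurableSet_accurateSet (hf₁ : ∀ i, Differentiable ℝ (f i))
    (hf₂ : ∀ i, Differentiable ℝ (gradient (f i))) (a τg τh : ℝ) (bg bh : ℕ) :
    MeasurableSet (accurateSet f a τg τh bg bh) := by
  have : ProperSpace (EucSp n →L[ℝ] EucSp n) := FiniteDimensional.proper ℝ _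
  have hF : Continuous (finiteSum f) := by
    unfold finiteSum
    exact continuous_const.mul (continuous_finsetSum _ fun i _ => (hf₁ i).continuous)
  have hgF : Continuous (gradient (finiteSum f)) := by
    rw [funext (gradient_finiteSum hf₁)]
    exact Continuous.fun_const_smul
      (continuous_finsetSum _ fun i _ => (hf₂ i).continuous) (1 / (m : ℝ))
  have hsg (s : Fin bg → Fin m) : Continuous (subGradient f s) :=
    Continuous.fun_const_smul
      (continuous_finsetSum _ fun j _ => (hf₂ (s j)).continuous) (1 / (bg : ℝ))
  -- The component Hessians need not be continuous; as derivatives they are still measurable.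
  have hh (u : EucSp n → ℝ) : Measurable (hessian u) := measurable_fderiv ℝ _
  have hsh (s : Fin bh → Fin m) : Measurable (subHessian f s) :=
    (Finset.measurable_fun_sum _ fun j _ => hh (f (s j))).fun_const_smul (1 / (bh : ℝ))
  refine measurableSet_setOfPred.2 (measurable_from_prod_countable_right fun s => ?_)
  refine Measurable.imp (measurableSet_setOfPred.1 (measurableSet_le hF.measurable measurable_const))
    (Measurable.and (measurableSet_setOfPred.1 ?_) (measurableSet_setOfPred.1 ?_))
  · exact measurableSet_le ((hsg s.1).sub hgF).norm.measurable measurable_const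
  · exact measurableSet_le ((hsh s.2).sub (hh _)).norm measurable_const

variable {Ω : Type*} [MeasurableSpace Ω] {μ : Measure Ω} [IsProbabilityMeasure μ]

theorem one_sub_le_measureReal_accurateSet (hf₁ : ∀ i, Differentiable ℝ (f i))
    (hf₂ : ∀ i, Differentiable ℝ (gradient (f i))) (hn : 0 < n) (hm : 0 < m) {bg bh : ℕ}
    {Sg : Ω → Fin bg → Fin m} {Sh : Ω → Fin bh → Fin m} (hSg : Measurable Sg)
    (hSh : Measurable Sh) (hug : IsUniformBatch μ Sg) (huh : IsUniformBatch μ Sh)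
    (hind : IndepFun Sg Sh μ) {Ug Uh τg τh δ a : ℝ} (hUg : 0 < Ug) (hUh : 0 < Uh)
    (hτg : 0 < τg) (hτh : 0 < τh) (hδ : 0 < δ ∧ δ < 1)
    (hgrad : ∀ i x, finiteSum f x ≤ a → ‖gradient (f i) x‖ ≤ Ug)
    (hhess : ∀ i x, finiteSum f x ≤ a → ‖hessian (f i) x‖ ≤ Uh)
    (hbg : Ug ^ 2 * (1 + √(8 * Real.log (1 / δ))) ^ 2 / τg ^ 2 ≤ bg)
    (hbh : 16 * Uh ^ 2 / τh ^ 2 * Real.log (2 * (n : ℝ) / δ) ≤ bh) (y : EucSp n) :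
    1 - δ ≤ μ.real {ω | ((Sg ω, Sh ω), y) ∈ accurateSet f a τg τh bg bh} := by
  by_cases hy : finiteSum f y ≤ a
  swap
  · have : {ω | ((Sg ω, Sh ω), y) ∈ accurateSet f a τg τh bg bh} = Set.univ :=
      Set.eq_univ_of_forall fun ω h => absurd h hy
    rw [this, probReal_univ]
    linarith [hδ.1]
  have hbh0 : 0 < bh := by
    have hlog : 0 < Real.log (2 * (n : ℝ) / δ) := by
      have hn1 : (1 : ℝ) ≤ n := by exact_mod_cast hn
      exact Real.log_pos (by rw [lt_div_iff₀ hδ.1]; linarith [hδ.2])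
    have : (0 : ℝ) < bh := lt_of_lt_of_le (by positivity) hbh
    exact_mod_cast this
  set Tg : Set (Fin bg → Fin m) := {s | ‖subGradient f s y - gradient (finiteSum f) y‖ ≤ τg}
  set Th : Set (Fin bh → Fin m) := {s | ‖subHessian f s y - hessian (finiteSum f) y‖ ≤ τh}
  have hg := hug.measureReal_norm_average_sub_mean_le hSg hm (fun i => gradient (f i) y) hUg
    (fun i => hgrad i y hy) hδ hτg hbg
  have hh := (huh.measureReal_norm_average_operator_sub_mean_le hSh hm (fun i => hessian (f i) y)
    (fun i => hessian_isSymmetric (hf₁ i) (hf₂ i y)) hUh (fun i => hhess i y hy) hτh hbh0).trans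
    ((by simp : _ = _).trans_le (two_mul_exp_le hn hδ hUh hτh hbh))
  have eg : {ω | τg < ‖(1 / (bg : ℝ)) • ∑ j, gradient (f (Sg ω j)) y
      - (1 / (m : ℝ)) • ∑ i, gradient (f i) y‖} = (Sg ⁻¹' Tg)ᶜ := by
    ext ω
    simp [Tg, subGradient, gradient_finiteSum hf₁]
  have eh : {ω | τh < ‖(1 / (bh : ℝ)) • ∑ j, hessian (f (Sh ω j)) y
      - (1 / (m : ℝ)) • ∑ i, hessian (f i) y‖} = (Sh ⁻¹' Th)ᶜ := by
    ext ω
    simp [Th, subHessian, hessian_finiteSum hf₁ hf₂]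
  rw [eg, probReal_compl_eq_one_sub (hSg MeasurableSet.of_discrete)] at hg
  rw [eh, probReal_compl_eq_one_sub (hSh MeasurableSet.of_discrete)] at hh
  have e : {ω | ((Sg ω, Sh ω), y) ∈ accurateSet f a τg τh bg bh} = Sg ⁻¹' Tg ∩ Sh ⁻¹' Th := by
    ext ω
    simp [accurateSet, Tg, Th, hy]
  rw [e, measureReal_def, hind.measure_inter_preimage_eq_mul _ _ MeasurableSet.of_discrete
    MeasurableSet.of_discrete, ENNReal.toReal_mul, ← measureReal_def, ← measureReal_def]
  simpa using one_sub_le_mul_one_sub hδ hg hh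

end Sampling

/-! ### Chaining over the iterations, and the conclusion. -/

theorem pow_le_measureReal_forall_lt {Ω : Type*} {mΩ : MeasurableSpace Ω} {μ : Measure Ω}
    [IsProbabilityMeasure μ] {ℱ : Filtration ℕ mΩ} {X : Type*} [MeasurableSpace X]
    {A : ℕ → Type*} [∀ k, MeasurableSpace (A k)] {S : (k : ℕ) → Ω → A k} {x : ℕ → Ω → X}
    (hS : ∀ k, Measurable[ℱ (k + 1)] (S k)) (hx : ∀ k, Measurable[ℱ k] (x k))
    (hind : ∀ k, Indep (MeasurableSpace.comap (S k) inferInstance) (ℱ k) μ)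
    {G : (k : ℕ) → Set (A k × X)} (hG : ∀ k, MeasurableSet (G k)) {c : ℝ} (hc : 0 ≤ c)
    (hgood : ∀ k y, c ≤ μ.real {ω | (S k ω, y) ∈ G k}) (K : ℕ) :
    c ^ K ≤ μ.real {ω | ∀ k < K, (S k ω, x k ω) ∈ G k} := by
  -- Accuracy before iteration `K` is decided by `ℱ K`, hence independent of the batches drawn at
  -- iteration `K`.
  have hmeas (K : ℕ) : MeasurableSet[ℱ K] {ω | ∀ k < K, (S k ω, x k ω) ∈ G k} := by
    have e : {ω | ∀ k < K, (S k ω, x k ω) ∈ G k}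
        = ⋂ k, ⋂ (_ : k < K), {ω | (S k ω, x k ω) ∈ G k} := by ext; simp
    rw [e]
    refine MeasurableSet.iInter fun k => MeasurableSet.iInter fun hk => ?_
    exact (((hS k).mono (ℱ.mono hk) le_rfl).prodMk ((hx k).mono (ℱ.mono hk.le) le_rfl)) (hG k)
  induction K with
  | zero => simp
  | succ K ih =>
    have e : {ω | ∀ k < K + 1, (S k ω, x k ω) ∈ G k}
        = {ω | ∀ k < K, (S k ω, x k ω) ∈ G k} ∩ {ω | (S K ω, x K ω) ∈ G K} := by
      ext ω
      simp only [Set.mem_ofPred_eq, Set.mem_inter_iff]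
      exact Nat.forall_lt_succ_right
    rw [e, pow_succ']
    exact (mul_le_mul_of_nonneg_left ih hc).trans (mul_measureReal_le_of_indep (ℱ.le K)
      ((hS K).mono (ℱ.le _) le_rfl) (hind K) (hx K) (hmeas K) (hG K) hc (hgood K))

theorem mainTheorem10
    {Ω : Type*} [mΩ : MeasurableSpace Ω] (μ : Measure Ω) [IsProbabilityMeasure μ]
    {n m : ℕ} (f : Fin m → EucSp n → ℝ)
    -- the components are twice differentiable, the objective meets the standing assumptions
    (hf₁ : ∀ i, Differentiable ℝ (f i)) (hf₂ : ∀ i, Differentiable ℝ (gradient (f i)))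
    (L : ℝ) (hL : 0 < L) (hF : SmoothObjective (finiteSum f) L)
    (fstar : ℝ) (hfstar : IsLeast (Set.range (finiteSum f)) fstar)
    -- the input of the method
    (x₀ : EucSp n) (γ : ℝ) (hγ : 1 < γ)
    (η : ℕ → ℝ) (hη : ∀ k, 0 ≤ η k ∧ η k < 1)
    (δgBar : ℝ) (hδgBar : δgBar < 1 / 2) (δg : ℕ → ℝ) (hδg : ∀ k, 0 < δg k ∧ δg k ≤ δgBar)
    (δhBar : ℝ) (δh : ℕ → ℝ) (hδh : ∀ k, 0 < δh k ∧ δh k ≤ δhBar)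
    (ε : ℝ) (hε : 0 < ε) (δbar : ℝ) (hδbar : 0 < δbar ∧ δbar < 1)
    -- bounds of the component derivatives on the level set of the starting point
    (Ug Uh : ℝ) (hUg : 0 < Ug) (hUh : 0 < Uh)
    (hgrad : ∀ i x, finiteSum f x ≤ finiteSum f x₀ → ‖gradient (f i) x‖ ≤ Ug)
    (hhess : ∀ i x, finiteSum f x ≤ finiteSum f x₀ → ‖hessian (f i) x‖ ≤ Uh)
    -- the batch sizes
    (bg bh : ℕ → ℕ)
    (hbg : ∀ k, Ug ^ 2 * (1 + Real.sqrt (8 * Real.log (1 / δbar))) ^ 2 / (δg k ^ 2 * ε ^ 2)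
      ≤ (bg k : ℝ))
    (hbh : ∀ k, 16 * Uh ^ 2 / δh k ^ 2 * Real.log (2 * (n : ℝ) / δbar) ≤ (bh k : ℝ))
    -- the random batches, the iterates, and the approximate gradients `g k`
    (ℱ : Filtration ℕ mΩ)
    (Sg : (k : ℕ) → Ω → Fin (bg k) → Fin m) (Sh : (k : ℕ) → Ω → Fin (bh k) → Fin m)
    (x g : ℕ → Ω → EucSp n)
    (hsample : IsSubsampling μ ℱ Sg Sh x)
    (hg : ∀ k ω, g k ω = subGradient f (Sg k ω) (x k ω))
    (hrun : ∀ ω, IsRegNewtonRun L γ η δg δh x₀ (fun k => g k ω)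
      (fun k => subHessian f (Sh k ω) (x k ω)) (fun k => x k ω))
    (K : ℕ) (hK : K = iterBound L γ δgBar δhBar (finiteSum f x₀ - fstar) ε) :
    -- within `K` iterations the method reaches a point with gradient norm at most `2 ε`
    (1 - δbar) ^ K ≤ μ.real {ω | ∃ k ≤ K, ‖gradient (finiteSum f) (x k ω)‖ ≤ 2 * ε} ∧
    -- and, unless `x₀` is already optimal, the test `‖g k‖ ≤ ε` stops it at such a point
    (fstar < finiteSum f x₀ →
      (1 - δbar) ^ K ≤ μ.real {ω | ∃ k ≤ K, (∀ j < k, ε < ‖g j ω‖) ∧ ‖g k ω‖ ≤ ε ∧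
        ‖gradient (finiteSum f) (x k ω)‖ ≤ 2 * ε}) := by
  set F := finiteSum f with hFdef
  obtain ⟨⟨y₀, hy₀⟩, hlow⟩ := hfstar
  have hδ1 : 0 ≤ 1 - δbar := by linarith [hδbar.2]
  have htermination : fstar < F x₀ →
      (1 - δbar) ^ K ≤ μ.real {ω | ∃ k ≤ K, (∀ j < k, ε < ‖g j ω‖) ∧ ‖g k ω‖ ≤ ε ∧
        ‖gradient F (x k ω)‖ ≤ 2 * ε} := by
    intro hgap
    -- A positive gap excludes the degenerate cases: for `m = 0` the objective vanishes, and for `n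
    -- = 0` the space is a point.
    have hm : 0 < m := by
      rcases Nat.eq_zero_or_pos m with rfl | h
      · simp only [hFdef, finiteSum, Finset.univ_eq_empty, Finset.sum_empty, mul_zero] at hgap hy₀
        linarith
      · exact h
    have hn : 0 < n := by
      rcases Nat.eq_zero_or_pos n with rfl | h
      · rw [← hy₀, Subsingleton.elim y₀ x₀] at hgap
        exact absurd hgap (lt_irrefl _)
      · exact h
    have hchain := pow_le_measureReal_forall_lt (μ := μ) (ℱ := ℱ)
      (S := fun k ω => (Sg k ω, Sh k ω)) (x := x)
      (fun k => (hsample.measurable_gradBatch k).prodMk (hsample.measurable_hessBatch k))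
      hsample.measurable_iterate hsample.indep_past
      (G := fun k => accurateSet f (F x₀) (δg k * ε) (δh k) (bg k) (bh k))
      (fun k => measurableSet_accurateSet hf₁ hf₂ _ _ _ _ _) hδ1
      (fun k y => one_sub_le_measureReal_accurateSet hf₁ hf₂ hn hm
        ((hsample.measurable_gradBatch k).mono (ℱ.le _) le_rfl)
        ((hsample.measurable_hessBatch k).mono (ℱ.le _) le_rfl)
        (hsample.uniform_gradBatch k) (hsample.uniform_hessBatch k) (hsample.indep_batches k)
        hUg hUh (mul_pos (hδg k).1 hε) (hδh k).1 hδbar hgrad hhess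
        (by rw [mul_pow]; exact hbg k) (hbh k) y) K
    refine hchain.trans (measureReal_mono fun ω hω => ?_)
    rw [hK]
    refine exists_stopping_iteration hL hF hlow hγ hη hδgBar hδg hδh hε (hrun ω)
      (fun k => subHessian_isSymmetric hf₁ hf₂ _ _) hgap fun k hk hlev => ?_
    rw [hg k ω]
    exact hω k (hK ▸ hk) hlev
  refine ⟨?_, htermination⟩
  by_cases hgap : fstar < F x₀
  · refine (htermination hgap).trans (measureReal_mono fun ω hω => ?_)
    obtain ⟨k, hk, -, -, h⟩ := hω
    exact ⟨k, hk, h⟩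
  -- Without a gap, `x₀` is a minimizer with zero gradient, and `k = 0` serves for every outcome.
  · have hmin : IsLocalMin F x₀ :=
      Filter.Eventually.of_forall fun z => (not_lt.1 hgap).trans (hlow ⟨z, rfl⟩)
    have huniv : {ω | ∃ k ≤ K, ‖gradient F (x k ω)‖ ≤ 2 * ε} = Set.univ :=
      Set.eq_univ_of_forall fun ω => ⟨0, Nat.zero_le _, by
        rw [(hrun ω).init, gradient, hmin.fderiv_eq_zero, map_zero, norm_zero]
        positivity⟩
    rw [huniv, probReal_univ]
    exact pow_le_one₀ hδ1 (by linarith [hδbar.1])
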